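/- **Setting.** A two-hop decode-and-forward relay link has nonzero channel gains $h_1$ (source–relay) and $h_2$ (relay–destination), noise variance $N_0>0$, self-interference factor $\beta>0$, average source power $\bar P>0$, average relay power $\bar p>0$ and maximum relay power $p^{\max}>0$ (no limit on the instantaneous source power). Put $v=|h_2|^2/N_0$, $\beta_0=\beta/N_0$, $\bar{\mathcal P}=\bar P|h_1|^2/\beta$, $W=\bar{\mathcal P}+\bar p$. Consider the problem of maximizing $R=\min\{R_1,R_2\}$ over probability distributions $f$ on $[0,p^{\max}]$ and real $\omega$ with $\int p\,df=\bar p$ and $\int[\omega-p]^+df=\bar{\mathcal P}$, where $$R_1=\int\log\Big(1+\tfrac{\beta_0[\omega-p]^+}{1+\beta_0p}\Big)df(p),\qquad R_2=\int\log(1+vp)\,df(p),$$ and the source uses power $P(p)=\frac{\beta}{|h_1|^2}[\omega-p]^+$ when the relay uses power $p$. Let $$\mathcal P_0=p^{\max}-\bar p,\quad \mathcal P_2=\bar p\tfrac{v}{\beta_0}(1+\bar p\beta_0),\quad \mathcal P_3=\tfrac{p^{\max}-\bar p}{p^{\max}\beta_0}\Big[(1+p^{\max}v)^{\bar p/(p^{\max}-\bar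 p)}-1\Big],$$ and let $\mathcal P_4>0$ be the number (its existence is part of the claim) such that, for $x>0$, $\bar p\log(1+v(x+\bar p))\le x\log(1+(x+\bar p)\beta_0)$ if and only if $x\ge\mathcal P_4$. Suppose $\bar{\mathcal P}<\mathcal P_0$. **Reduction.** Let $$\Omega=\Big\{(\omega,F):\tfrac{p^{\max}\bar{\mathcal P}}{p^{\max}-\bar p}\le\omega\le W,\ \tfrac{\bar{\mathcal P}}{\omega}\le F\le\tfrac{p^{\max}-W}{p^{\max}-\omega}\Big\},$$ with vertices $V_1=\big(\tfrac{p^{\max}\bar{\mathcal P}}{p^{\max}-\bar p},1-\tfrac{\bar p}{p^{\max}}\big)$, $V_2=(W,1)$, $V_3=(W,\bar{\mathcal P}/W)$, and write $m(\omega,F)=\frac{W-F\omega}{1-F}$ (terms with the factor $1-F$ are $0$ when $F=1$). For $(\omega,F)\in\Omega$ and a probability distribution $g$ on $[0,\omega]$ with mean $\omega-\bar{\mathcal P}/F$, put $$\rho_1=F\log(1+\beta_0\omega)-F\!\int\!\log(1+\beta_0p)\,dg,\qquad \rho_2=F\!\int\!\log(1+vp)\,dg+(1-F)\log(1+v\,m(\omega,F)).$$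 Every feasible $(f,\omega)$ has $\omega<p^{\max}$ and $(\omega,F)\in\Omega$ for $F=f([0,\omega])$, and there is such a $g$ with $R_1=\rho_1$, $R_2\le\rho_2$. Conversely, for $(\omega,F)\in\Omega$ and such $g$, $f=Fg+(1-F)\delta_{m(\omega,F)}$ is feasible with $\omega$ and has $R_1=\rho_1$, $R_2=\rho_2$. In particular a number is the maximum of $\min\{R_1,R_2\}$ if and only if it is the maximum of $\min\{\rho_1,\rho_2\}$ over $(\omega,F)\in\Omega$ and $g$. **Subregions.** Put $$R_1^{\min}=F\log\tfrac{F(1+\omega\beta_0)}{F(1+\omega\beta_0)-\bar{\mathcal P}\beta_0},\quad R_2^{\max}=F\log\big(1+v(\omega-\tfrac{\bar{\mathcal P}}F)\big)+(1-F)\log(1+v\,m),$$ $$R_1^{\max}=\tfrac{\bar{\mathcal P}}{\omega}\log(1+\beta_0\omega),\quad R_2^{\min}=\big(F-\tfrac{\bar{\mathcal P}}\omega\big)\log(1+v\omega)+(1-F)\log(1+v\,m),$$ $Q_1=R_1^{\min}-R_2^{\max}$, $Q_2=R_2^{\min}-R_1^{\max}$, $\Omega_1=\{Q_1\ge0\}\cap\Omega$,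 $\Omega_2=\{Q_2\ge0\}\cap\Omega$, $\Omega_3=\Omega\setminus(\Omega_1\cup\Omega_2)$. At each point of $\Omega_1$ the maximum of $\min\{\rho_1,\rho_2\}$ over $g$ is $R_2^{\max}$; at each point of $\Omega_2$ it is $R_1^{\max}$; at each point of $\Omega_3$, for every $g$ there is an admissible $g'$ with $\rho_1(g')=\rho_2(g')\ge\min\{\rho_1(g),\rho_2(g)\}$. Moreover $$\bar{\mathcal P}\le\mathcal P_3\iff Q_2(V_1)\ge0,\qquad \bar{\mathcal P}\ge\mathcal P_2\iff Q_1(V_2)\ge0,\qquad \bar{\mathcal P}\ge\mathcal P_4\iff Q_1(V_3)\ge0,$$ $\Omega_2=\Omega\iff\bar{\mathcal P}\le\mathcal P_3$; $\ \Omega_1=\Omega\iff\bar{\mathcal P}\ge\max\{\mathcal P_2,\mathcal P_4\}$; $\ \Omega_1\neq\emptyset\iff\bar{\mathcal P}\ge\mathcal P_3$; $\ \Omega_2\ne\emptyset\iff\bar{\mathcal P}\le\mathcal P_4$; $\ \Omega_3\ne\emptyset\iff\mathcal P_3<\bar{\mathcal P}<\max\{\mathcal P_2,\mathcal P_4\}$.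 **Optimal allocation.** 1. If $\bar{\mathcal P}\le\mathcal P_3$: $f^\star=\frac{\bar p}{p^{\max}}\delta_{p^{\max}}+\big(1-\frac{\bar p}{p^{\max}}\big)\delta_0$ is optimal, with $\omega=\frac{p^{\max}\bar{\mathcal P}}{p^{\max}-\bar p}$; the source power is $0$ when $p=p^{\max}$ and $\frac{\beta}{|h_1|^2}\frac{p^{\max}\bar{\mathcal P}}{p^{\max}-\bar p}$ when $p=0$ (half-duplex); the maximum rate is $\big(1-\frac{\bar p}{p^{\max}}\big)\log\Big(1+\frac{p^{\max}\bar{\mathcal P}\beta_0}{p^{\max}-\bar p}\Big)$. 2. If $\bar{\mathcal P}\ge\max\{\mathcal P_2,\mathcal P_4\}$: $f^\star=\delta_{\bar p}$ is optimal, with $\omega=W$ and source power $\frac{\beta}{|h_1|^2}\bar{\mathcal P}=\bar P$ (full-duplex over the whole frame); the maximum rate is $\log(1+\bar pv)$. 3. If $v\ge\beta_0$ and $\mathcal P_3<\bar{\mathcal P}<\max\{\mathcal P_2,\mathcal P_4\}$: $R_1^{\min}$ attains its maximum over $\{(\omega,F)\in\Omega:Q_1(\omega,F)=0\}$, and for every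 maximizer $(\omega^\star,F^\star)$ one has $0<F^\star<1$ and the distribution $$f^\star=(1-F^\star)\,\delta_{p_A}+F^\star\,\delta_{p_B},\qquad p_A=\frac{W-F^\star\omega^\star}{1-F^\star}>0,\quad p_B=\omega^\star-\frac{\bar{\mathcal P}}{F^\star}\ge0,$$ is optimal, with $\omega=\omega^\star$ and maximum rate $R_1^{\min}(\omega^\star,F^\star)$. The source power is $0$ in the phase with $p=p_A$ (half-duplex transmission by the relay) and $\frac{\beta}{|h_1|^2}\frac{\bar{\mathcal P}}{F^\star}$ in the phase with $p=p_B$, which is full-duplex if $p_B>0$ and half-duplex reception if $p_B=0$; if $\bar{\mathcal P}>\mathcal P_4$, then $p_B>0$. -/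

import Mathlib

open MeasureTheory Set

noncomputable section

/-- A two-hop decode-and-forward relay link: channel gains `h₁` (source-relay) and `h₂`
(relay-destination), noise variance `N₀`, self-interference attenuation factor `β`, average
source power `Pavg`, average relay power `pavg`, maximum relay power `pmax`. -/
structure RelaySystem where
  h₁ : ℂ
  h₂ : ℂ
  N₀ : ℝ
  β : ℝ
  Pavg : ℝ
  pavg : ℝ
  pmax : ℝ
  h₁_ne : h₁ ≠ 0
  h₂_ne : h₂ ≠ 0
  N₀_pos : 0 < N₀
  β_pos : 0 < β
  Pavg_pos : 0 < Pavg
  pavg_pos : 0 < pavg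
  pmax_pos : 0 < pmax

namespace RelaySystem

variable (S : RelaySystem)

/-- Normalized relay-destination gain `v = |h₂|² / N₀`. -/
def v : ℝ := ‖S.h₂‖ ^ 2 / S.N₀

/-- Normalized self-interference `β₀ = β / N₀`. -/
def β₀ : ℝ := S.β / S.N₀

/-- Normalized average source power `𝒫 = P |h₁|² / β`. -/
def Pnorm : ℝ := S.Pavg * ‖S.h₁‖ ^ 2 / S.β

/-- Source power used when the relay transmits with power `p`, for water level `ω`. -/
def sourcePower (ω p : ℝ) : ℝ := S.β / ‖S.h₁‖ ^ 2 * max (ω - p) 0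

/-! ### The allocation problem over relay power distributions -/

/-- `f` is a probability distribution of the relay power on `[0, pmax]` with average `pavg`, and
`ω` is a water level that meets the average source power constraint. -/
def IsFeasible (f : Measure ℝ) (ω : ℝ) : Prop :=
  IsProbabilityMeasure f ∧ f (Icc 0 S.pmax)ᶜ = 0 ∧ ∫ p, p ∂f = S.pavg ∧
    ∫ p, max (ω - p) 0 ∂f = S.Pnorm

/-- Average rate of the source-relay link. -/
def R1 (f : Measure ℝ) (ω : ℝ) : ℝ :=
  ∫ p, Real.log (1 + S.β₀ * max (ω - p) 0 / (1 + S.β₀ * p)) ∂f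

/-- Average rate of the relay-destination link. -/
def R2 (f : Measure ℝ) : ℝ := ∫ p, Real.log (1 + S.v * p) ∂f

/-- Network rate. -/
def rate (f : Measure ℝ) (ω : ℝ) : ℝ := min (S.R1 f ω) (S.R2 f)

/-- The network rates of all feasible allocations. -/
def rates : Set ℝ := {r | ∃ f ω, S.IsFeasible f ω ∧ r = S.rate f ω}

/-- `(f, ω)` is feasible and attains the maximum network rate. -/
def IsOptimal (f : Measure ℝ) (ω : ℝ) : Prop :=
  S.IsFeasible f ω ∧ ∀ f' ω', S.IsFeasible f' ω' → S.rate f' ω' ≤ S.rate f ω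

/-- Probability distribution with mass `t` at `a` and mass `1 - t` at `b`. -/
def twoPoint (t a b : ℝ) : Measure ℝ :=
  ENNReal.ofReal t • Measure.dirac a + ENNReal.ofReal (1 - t) • Measure.dirac b

/-! ### The problem over the region `Ω` -/

/-- The region `Ω` of the `(ω, F)` plane. -/
def Omega : Set (ℝ × ℝ) :=
  {x | S.pmax * S.Pnorm / (S.pmax - S.pavg) ≤ x.1 ∧ x.1 ≤ S.Pnorm + S.pavg ∧
    S.Pnorm / x.1 ≤ x.2 ∧ x.2 ≤ (S.pmax - S.pavg - S.Pnorm) / (S.pmax - x.1)}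

/-- The vertices of `Ω`. -/
def V1 : ℝ × ℝ := (S.pmax * S.Pnorm / (S.pmax - S.pavg), 1 - S.pavg / S.pmax)

def V2 : ℝ × ℝ := (S.Pnorm + S.pavg, 1)

def V3 : ℝ × ℝ := (S.Pnorm + S.pavg, S.Pnorm / (S.Pnorm + S.pavg))

/-- Average relay power above the water level, `(𝒫 + p̄ - Fω) / (1 - F)`. -/
def upperMean (ω F : ℝ) : ℝ := (S.Pnorm + S.pavg - F * ω) / (1 - F)

/-- `g` is an admissible conditional distribution of the relay power given that it is at most
`ω`: a probability distribution on `[0, ω]` with average `ω - 𝒫 / F`. -/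
def IsInner (ω F : ℝ) (g : Measure ℝ) : Prop :=
  IsProbabilityMeasure g ∧ g (Icc 0 ω)ᶜ = 0 ∧ ∫ p, p ∂g = ω - S.Pnorm / F

/-- First-hop rate as a function of `(ω, F)` and `g`. -/
def innerR1 (ω F : ℝ) (g : Measure ℝ) : ℝ :=
  F * Real.log (1 + S.β₀ * ω) - F * ∫ p, Real.log (1 + S.β₀ * p) ∂g

/-- Second-hop rate as a function of `(ω, F)` and `g`. -/
def innerR2 (ω F : ℝ) (g : Measure ℝ) : ℝ :=
  F * (∫ p, Real.log (1 + S.v * p) ∂g) + (1 - F) * Real.log (1 + S.v * S.upperMean ω F)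

/-- The rates of the reduced problem at the point `(ω, F)`. -/
def innerRates (ω F : ℝ) : Set ℝ :=
  {r | ∃ g, S.IsInner ω F g ∧ r = min (S.innerR1 ω F g) (S.innerR2 ω F g)}

/-- The rates of the reduced problem over `Ω`. -/
def omegaRates : Set ℝ := {r | ∃ ω F, (ω, F) ∈ S.Omega ∧ r ∈ S.innerRates ω F}

/-- The distribution on `[0, pmax]` built from `(ω, F)` and `g`. -/
def glue (ω F : ℝ) (g : Measure ℝ) : Measure ℝ :=
  ENNReal.ofReal F • g + ENNReal.ofReal (1 - F) • Measure.dirac (S.upperMean ω F)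

/-! ### Bounds and subregions -/

def R1min (ω F : ℝ) : ℝ :=
  F * Real.log (F * (1 + ω * S.β₀) / (F * (1 + ω * S.β₀) - S.Pnorm * S.β₀))

def R2max (ω F : ℝ) : ℝ :=
  F * Real.log (1 + S.v * (ω - S.Pnorm / F)) + (1 - F) * Real.log (1 + S.v * S.upperMean ω F)

def R1max (ω : ℝ) : ℝ := S.Pnorm / ω * Real.log (1 + S.β₀ * ω)

def R2min (ω F : ℝ) : ℝ :=
  (F - S.Pnorm / ω) * Real.log (1 + S.v * ω) + (1 - F) * Real.log (1 + S.v * S.upperMean ω F)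

def Q1 (ω F : ℝ) : ℝ := S.R1min ω F - S.R2max ω F

def Q2 (ω F : ℝ) : ℝ := S.R2min ω F - S.R1max ω

def Omega1 : Set (ℝ × ℝ) := {x | x ∈ S.Omega ∧ S.R2max x.1 x.2 ≤ S.R1min x.1 x.2}

def Omega2 : Set (ℝ × ℝ) := {x | x ∈ S.Omega ∧ S.R1max x.1 ≤ S.R2min x.1 x.2}

def Omega3 : Set (ℝ × ℝ) := S.Omega \ (S.Omega1 ∪ S.Omega2)

/-- The part of the curve `Q₁ = 0` that lies in `Ω`. -/
def curve : Set (ℝ × ℝ) := {x | x ∈ S.Omega ∧ S.Q1 x.1 x.2 = 0}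

/-! ### Thresholds for the normalized average source power -/

def P0 : ℝ := S.pmax - S.pavg

def P2 : ℝ := S.pavg * S.v / S.β₀ * (1 + S.pavg * S.β₀)

def P3 : ℝ :=
  (S.pmax - S.pavg) / (S.pmax * S.β₀) *
    ((1 + S.pmax * S.v) ^ (S.pavg / (S.pmax - S.pavg)) - 1)

/-- The inequality whose solution set `[𝒫₄, ∞)` defines `𝒫₄`. -/
def P4Ineq (x : ℝ) : Prop :=
  S.pavg * Real.log (1 + S.v * (x + S.pavg)) ≤ x * Real.log (1 + (x + S.pavg) * S.β₀)

def P4 : ℝ := sInf {x | 0 < x ∧ S.P4Ineq x}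

end RelaySystem

end

namespace RelaySystem

/-! Everything rests on the concavity of `log (1 + k x)`, which vanishes at `0`. Let `F` be the mass
of `f` at or below the water level `ω`. The two average constraints fix the means of the parts of
`f` below and above `ω`. The first hop sees only the lower part, and by Jensen the second hop gains
when the upper part is concentrated at its mean. This is the reduction to a point of `Ω` and an
inner distribution `g` (`IsFeasible.exists_inner`, `glue_spec`).

At a fixed `(ω, F)` the mean of `g` on `[0, ω]` is prescribed. Concentrating `g` at its mean is
worst for the first hop and best for the second; spreading it over `{0, ω}` does the reverse. If one
hop stays the bottleneck at its own best extreme, that extreme is optimal; otherwise mixing `g` with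
an extreme equalizes the hops (`exists_balanced_inner`). The same concavity shows that `Q1` is least
at `V2`, `Q1` greatest and `Q2` least at `V1`, and `Q2` greatest at `V3`, so the thresholds only
record signs at vertices.

In the intermediate case with `β₀ ≤ v`, any `g` is beaten by a point mass at the same `ω` and a
smaller `F'`, chosen to keep the first-hop rate (`exists_le_min_bounds`). The second hop does not
lose because `log (1 + v p)` lies below a combination of `1`, `p`, `log (1 + β₀ p)` touching it at
the point mass and at `ω` (`exists_log_dominating`). What remains is to maximize `min R1min R2max`
over `Ω`, and monotonicity along suitable paths pushes every point to the curve `Q1 = 0`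
(`exists_curve_min_le`). Compactness of the curve gives the maximizer. -/

/-! ### Concavity inequalities for `log (1 + k x)`. -/

lemma strictConcaveOn_log_one_add_mul {k : ℝ} (hk : 0 < k) :
    StrictConcaveOn ℝ (Ici 0) fun x : ℝ => Real.log (1 + k * x) := by
  refine ⟨convex_Ici 0, fun x hx y hy hxy s t hs ht hst => ?_⟩
  have hx' : 0 < 1 + k * x := by have := mul_nonneg hk.le hx; linarith
  have hy' : 0 < 1 + k * y := by have := mul_nonneg hk.le hy; linarith
  have hne : 1 + k * x ≠ 1 + k * y := fun h => hxy (mul_left_cancel₀ hk.ne' (by linarith))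
  have := strictConcaveOn_log_Ioi.2 (mem_Ioi.2 hx') (mem_Ioi.2 hy') hne hs ht hst
  have e : s • (1 + k * x) + t • (1 + k * y) = 1 + k * (s • x + t • y) := by
    simp only [smul_eq_mul]; linear_combination hst
  rwa [e] at this

/-- Merging masses at two points into their barycenter increases the average rate. -/
lemma merge_log {k s t u x y z : ℝ} (hk : 0 < k) (hs : 0 ≤ s) (ht : 0 ≤ t) (hx : 0 ≤ x)
    (hy : 0 ≤ y) (hu : s + t = u) (h : s * x + t * y = u * z) :
    s * Real.log (1 + k * x) + t * Real.log (1 + k * y) ≤ u * Real.log (1 + k * z) := by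
  rcases eq_or_lt_of_le (add_nonneg hs ht) with h0 | h0
  · have hs0 : s = 0 := by linarith
    have ht0 : t = 0 := by linarith
    simp [← hu, hs0, ht0]
  · rw [hu] at h0
    have := (strictConcaveOn_log_one_add_mul hk).concaveOn.2 (mem_Ici.2 hx) (mem_Ici.2 hy)
      (div_nonneg hs h0.le) (div_nonneg ht h0.le) (by rw [← add_div, hu, div_self h0.ne'])
    simp only [smul_eq_mul] at this
    have e : s / u * x + t / u * y = z := by field_simp; linarith
    rw [e] at this
    calc _ = u * (s / u * Real.log (1 + k * x) + t / u * Real.log (1 + k * y)) := by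
          field_simp
      _ ≤ _ := mul_le_mul_of_nonneg_left this h0.le

lemma chord_log {k x ω : ℝ} (hk : 0 < k) (hx : 0 ≤ x) (hω : x ≤ ω) :
    x * Real.log (1 + k * ω) ≤ ω * Real.log (1 + k * x) := by
  have := merge_log (u := ω) (z := x) hk hx (sub_nonneg.2 hω) (hx.trans hω) le_rfl
    (by ring) (by ring)
  simpa using this

lemma chord_log_lt {k x ω : ℝ} (hk : 0 < k) (hx : 0 < x) (hω : x < ω) :
    x * Real.log (1 + k * ω) < ω * Real.log (1 + k * x) := by
  have h0 : 0 < ω := hx.trans hω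
  have := (strictConcaveOn_log_one_add_mul hk).2 (mem_Ici.2 h0.le) (mem_Ici.2 le_rfl) h0.ne'
    (div_pos hx h0) (div_pos (sub_pos.2 hω) h0) (by field_simp; ring)
  simp only [smul_eq_mul, mul_zero, add_zero, Real.log_one] at this
  rw [div_mul_cancel₀ _ h0.ne', div_mul_eq_mul_div, div_lt_iff₀ h0] at this
  linarith

lemma log_one_add_mul_nonneg {k x : ℝ} (hk : 0 < k) (hx : 0 ≤ x) :
    0 ≤ Real.log (1 + k * x) :=
  Real.log_nonneg (by have := mul_nonneg hk.le hx; linarith)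

lemma log_one_add_mul_pos {k x : ℝ} (hk : 0 < k) (hx : 0 < x) :
    0 < Real.log (1 + k * x) :=
  Real.log_pos (by have := mul_pos hk hx; linarith)

lemma log_one_add_mul_mono {k x y : ℝ} (hk : 0 < k) (hx : 0 ≤ x) (hxy : x ≤ y) :
    Real.log (1 + k * x) ≤ Real.log (1 + k * y) := by
  have := mul_nonneg hk.le hx
  exact Real.log_le_log (by linarith) (by gcongr)

lemma one_add_mul_pos {k x : ℝ} (hk : 0 < k) (hx : 0 ≤ x) : 0 < 1 + k * x := by
  have := mul_nonneg hk.le hx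
  linarith

lemma log_le_tangent {k a x : ℝ} (hk : 0 < k) (ha : 0 ≤ a) (hx : 0 ≤ x) :
    Real.log (1 + k * x) ≤ Real.log (1 + k * a) + k / (1 + k * a) * (x - a) := by
  have ha' := one_add_mul_pos hk ha
  have hx' := one_add_mul_pos hk hx
  have := Real.log_le_sub_one_of_pos (div_pos hx' ha')
  rw [Real.log_div hx'.ne' ha'.ne'] at this
  have e : (1 + k * x) / (1 + k * a) - 1 = k / (1 + k * a) * (x - a) := by
    field_simp; ring
  linarith

/-- Moving two masses towards each other without changing
the barycenter increases the average rate. -/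
lemma contract_log {k F x y x' y' : ℝ} (hk : 0 < k) (hF : 0 ≤ F) (hF1 : F ≤ 1) (hx : 0 ≤ x)
    (hxx : x ≤ x') (hxy : x' ≤ y') (hyy : y' ≤ y)
    (h : F * x + (1 - F) * y = F * x' + (1 - F) * y') :
    F * Real.log (1 + k * x) + (1 - F) * Real.log (1 + k * y) ≤
      F * Real.log (1 + k * x') + (1 - F) * Real.log (1 + k * y') := by
  rcases eq_or_lt_of_le (hxx.trans (hxy.trans hyy)) with h0 | h0
  · have h1 : x' = x := by linarith
    have h2 : y' = x := by linarith
    rw [← h0, h1, h2]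
  have hd : 0 < y - x := sub_pos.2 h0
  have hy : 0 ≤ y := hx.trans h0.le
  have h1 := merge_log (k := k) (s := (y - x') / (y - x)) (t := (x' - x) / (y - x)) (u := 1)
    (z := x') hk (div_nonneg (by linarith) hd.le) (div_nonneg (by linarith) hd.le) hx hy
    (by field_simp; ring) (by field_simp; ring)
  have h2 := merge_log (k := k) (s := (y - y') / (y - x)) (t := (y' - x) / (y - x)) (u := 1)
    (z := y') hk (div_nonneg (by linarith) hd.le) (div_nonneg (by linarith) hd.le) hx hy
    (by field_simp; ring) (by field_simp; ring)
  have h3 := mul_le_mul_of_nonneg_left h1 hF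
  have h4 := mul_le_mul_of_nonneg_left h2 (sub_nonneg.2 hF1)
  have e1 : F * ((y - x') / (y - x)) + (1 - F) * ((y - y') / (y - x)) = F := by
    field_simp; linarith
  have e2 : F * ((x' - x) / (y - x)) + (1 - F) * ((y' - x) / (y - x)) = 1 - F := by
    field_simp; linarith
  calc _ = (F * ((y - x') / (y - x)) + (1 - F) * ((y - y') / (y - x))) * Real.log (1 + k * x)
        + (F * ((x' - x) / (y - x)) + (1 - F) * ((y' - x) / (y - x))) * Real.log (1 + k * y) := by
          rw [e1, e2]
    _ ≤ _ := by linarith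

/-! ### Extremality of the two-point distributions -/

/-- If `θ t = t - log (1 + t)`, `x ≤ y` and `δ` is the ratio `θ (y T) / θ (x T)`, then
`δ θ (x t) ≤ θ (y t)` to the left of `T`. -/
lemma ratio_sub_log {x y T δ : ℝ} (hx : 0 < x) (hxy : x ≤ y) (hT : 0 < T)
    (hδ : y * T - Real.log (1 + y * T) = δ * (x * T - Real.log (1 + x * T))) {t : ℝ}
    (ht : 0 < 1 + y * t) (htT : t ≤ T) :
    δ * (x * t - Real.log (1 + x * t)) ≤ y * t - Real.log (1 + y * t) := by
  have hy : 0 < y := hx.trans_le hxy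
  set D : ℝ → ℝ := fun t => (y * t - Real.log (1 + y * t)) - δ * (x * t - Real.log (1 + x * t))
    with hD
  have hposx : ∀ s, 0 < 1 + y * s → 0 < 1 + x * s := by
    intro s hs
    rcases le_total 0 s with h | h
    · exact one_add_mul_pos hx h
    · nlinarith
  have hder : ∀ s, 0 < 1 + y * s → HasDerivAt D
      (s * ((y ^ 2 - δ * x ^ 2) + x * y * (y - δ * x) * s) / ((1 + y * s) * (1 + x * s))) s := by
    intro s hs
    have hs' := hposx s hs
    have e : ∀ k : ℝ, 0 < 1 + k * s → HasDerivAt (fun t => k * t - Real.log (1 + k * t))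
        (k * 1 - (k * 1) / (1 + k * s)) s := fun k hk =>
      ((hasDerivAt_id s).const_mul k).sub
        ((((hasDerivAt_id s).const_mul k).const_add 1).log hk.ne')
    refine ((e y hs).sub ((e x hs').const_mul δ)).congr_deriv ?_
    have e2 : ∀ k : ℝ, 0 < 1 + k * s → k * 1 - k * 1 / (1 + k * s) = k ^ 2 * s / (1 + k * s) := by
      intro k hk
      rw [eq_div_iff hk.ne', sub_mul, div_mul_cancel₀ _ hk.ne']
      ring
    rw [e2 y hs, e2 x hs', ← mul_div_assoc, div_sub_div _ _ hs.ne' hs'.ne']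
    congr 1
    ring
  have hD0 : D 0 = 0 := by simp [hD]
  have hDT : D T = 0 := by simp only [hD]; linarith
  have hcont : ∀ a b, 0 < 1 + y * a → ContinuousOn D (Icc a b) := fun a b ha s hs =>
    (hder s (by nlinarith [hs.1])).continuousAt.continuousWithinAt
  have hderiv : ∀ s, 0 < 1 + y * s → deriv D s =
      s * ((y ^ 2 - δ * x ^ 2) + x * y * (y - δ * x) * s) / ((1 + y * s) * (1 + x * s)) :=
    fun s hs => (hder s hs).deriv
  -- Otherwise the affine factor of the derivative is negative on `(0, T)` and `D` strictly
  -- decreases there, against `D 0 = D T = 0`.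
  have hA : 0 ≤ y ^ 2 - δ * x ^ 2 := by
    by_contra! hA
    have hB : y - δ * x < 0 := by
      by_contra! hB
      nlinarith
    have : StrictAntiOn D (Icc 0 T) := by
      refine strictAntiOn_of_deriv_neg (convex_Icc 0 T) (hcont 0 T (by simp)) fun s hs => ?_
      rw [interior_Icc] at hs
      have h1 := one_add_mul_pos hy hs.1.le
      have h2 := one_add_mul_pos hx hs.1.le
      rw [hderiv s h1]
      have h3 : x * y * (y - δ * x) * s < 0 :=
        mul_neg_of_neg_of_pos (mul_neg_of_pos_of_neg (mul_pos hx hy) hB) hs.1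
      exact div_neg_of_neg_of_pos (mul_neg_of_pos_of_neg hs.1 (by linarith)) (mul_pos h1 h2)
    have := this ⟨le_rfl, hT.le⟩ ⟨hT.le, le_rfl⟩ hT
    linarith
  suffices 0 ≤ D t by simp only [hD] at this; linarith
  rcases le_total t 0 with h | h
  · have : AntitoneOn D (Icc t 0) := by
      refine antitoneOn_of_deriv_nonpos (convex_Icc t 0) (hcont t 0 ht)
        (fun s hs => ?_) fun s hs => ?_
      · rw [interior_Icc] at hs
        exact (hder s (by nlinarith [hs.1])).differentiableAt.differentiableWithinAt
      rw [interior_Icc] at hs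
      have h1 : 0 < 1 + y * s := by nlinarith [hs.1]
      have h2 := hposx s h1
      rw [hderiv s h1]
      have h3 : 0 ≤ (y ^ 2 - δ * x ^ 2) + x * y * (y - δ * x) * s := by
        -- A splitting of the affine factor into two terms that are nonnegative for `s < 0`, by `hA`
        -- and `x ≤ y`.
        have e : (y ^ 2 - δ * x ^ 2) + x * y * (y - δ * x) * s =
          (y ^ 2 - δ * x ^ 2) * (1 + y * s) + y * (y - x) * (-s * y) := by ring
        rw [e]
        have := hs.2
        have h5 : 0 ≤ -s * y := mul_nonneg (by linarith) hy.le
        have h6 : 0 ≤ y * (y - x) := mul_nonneg hy.le (by linarith)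
        positivity
      exact div_nonpos_of_nonpos_of_nonneg (mul_nonpos_of_nonpos_of_nonneg hs.2.le h3)
        (mul_pos h1 h2).le
    have := this ⟨le_rfl, h⟩ ⟨h, le_rfl⟩ h
    linarith
  · have h1 := one_add_mul_pos hy h
    -- The affine factor is nonnegative at `0`, so on `[0, T]` it changes sign at most once, from
    -- plus to minus. Hence `D` increases from `D 0 = 0` up to `t`, or decreases from `t` to `D T =
    -- 0`.
    by_cases hB : 0 ≤ (y ^ 2 - δ * x ^ 2) + x * y * (y - δ * x) * t
    · have : MonotoneOn D (Icc 0 t) := by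
        refine monotoneOn_of_deriv_nonneg (convex_Icc 0 t) (hcont 0 t (by simp))
          (fun s hs => ?_) fun s hs => ?_
        · rw [interior_Icc] at hs
          exact (hder s (one_add_mul_pos hy hs.1.le)).differentiableAt.differentiableWithinAt
        rw [interior_Icc] at hs
        have h2 := one_add_mul_pos hy hs.1.le
        have h3 := one_add_mul_pos hx hs.1.le
        rw [hderiv s h2]
        have h4 : 0 ≤ (y ^ 2 - δ * x ^ 2) + x * y * (y - δ * x) * s := by
          rcases le_total 0 (x * y * (y - δ * x)) with hc | hc
          · have := mul_nonneg hc hs.1.le; linarith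
          · have := mul_le_mul_of_nonpos_left hs.2.le hc; linarith
        exact div_nonneg (mul_nonneg hs.1.le h4) (mul_pos h2 h3).le
      have := this ⟨le_rfl, h⟩ ⟨h, le_rfl⟩ h
      linarith
    · push Not at hB
      have : AntitoneOn D (Icc t T) := by
        refine antitoneOn_of_deriv_nonpos (convex_Icc t T) (hcont t T h1)
          (fun s hs => ?_) fun s hs => ?_
        · rw [interior_Icc] at hs
          exact (hder s (one_add_mul_pos hy
            (h.trans hs.1.le))).differentiableAt.differentiableWithinAt
        rw [interior_Icc] at hs
        have h0 := h.trans hs.1.le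
        have h2 := one_add_mul_pos hy h0
        have h3 := one_add_mul_pos hx h0
        rw [hderiv s h2]
        have h4 : (y ^ 2 - δ * x ^ 2) + x * y * (y - δ * x) * s ≤ 0 := by
          rcases le_total 0 (x * y * (y - δ * x)) with hc | hc
          · have := mul_nonneg hc h; linarith
          · have := mul_le_mul_of_nonpos_left hs.1.le hc; linarith
        exact div_nonpos_of_nonpos_of_nonneg (mul_nonpos_of_nonneg_of_nonpos h0 h4)
          (mul_pos h2 h3).le
      have := this ⟨le_rfl, htT⟩ ⟨htT, le_rfl⟩ htT
      linarith

/-- For `b ≤ v`, the function `log (1 + v p)` is dominated on `[0, ω]` by a combination of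
`1`, `p`, `log (1 + b p)` that touches it at `a` and at `ω`. -/
lemma exists_log_dominating {b v a ω : ℝ} (hb : 0 < b) (hbv : b ≤ v) (ha : 0 ≤ a) (haω : a < ω) :
    ∃ A B δ : ℝ,
      (∀ p, 0 ≤ p → p ≤ ω → Real.log (1 + v * p) ≤ A + B * p + δ * Real.log (1 + b * p)) ∧
      A + B * a + δ * Real.log (1 + b * a) = Real.log (1 + v * a) ∧
      A + B * ω + δ * Real.log (1 + b * ω) = Real.log (1 + v * ω) := by
  have hv : 0 < v := hb.trans_le hbv
  have hba := one_add_mul_pos hb ha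
  have hva := one_add_mul_pos hv ha
  -- Recentring at `a`: `1 + k p = (1 + k a) (1 + k / (1 + k a) * (p - a))`. Subtracting the
  -- tangents at `a` then reduces the claim to `ratio_sub_log` with `t = p - a`, `T = ω - a`.
  set x := b / (1 + b * a) with hxdef
  set y := v / (1 + v * a) with hydef
  have hx : 0 < x := div_pos hb hba
  have hxy : x ≤ y := by
    rw [hxdef, hydef, div_le_div_iff₀ hba hva]; nlinarith
  have hT : 0 < ω - a := sub_pos.2 haω
  have key : ∀ k p : ℝ, 0 < k → 0 ≤ p →
      1 + k / (1 + k * a) * (p - a) = (1 + k * p) / (1 + k * a) := by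
    intro k p hk _
    have := one_add_mul_pos hk ha
    field_simp; ring
  have klog : ∀ k p : ℝ, 0 < k → 0 ≤ p →
      Real.log (1 + k / (1 + k * a) * (p - a)) = Real.log (1 + k * p) - Real.log (1 + k * a) := by
    intro k p hk hp
    rw [key k p hk hp, Real.log_div (one_add_mul_pos hk hp).ne' (one_add_mul_pos hk ha).ne']
  have hθ : 0 < x * (ω - a) - Real.log (1 + x * (ω - a)) := by
    have h0 : 0 < x * (ω - a) := mul_pos hx hT
    have := Real.log_lt_sub_one_of_pos (x := 1 + x * (ω - a)) (by linarith) (by linarith)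
    linarith
  set δ := (y * (ω - a) - Real.log (1 + y * (ω - a))) / (x * (ω - a) - Real.log (1 + x * (ω - a)))
    with hδdef
  have hδ : y * (ω - a) - Real.log (1 + y * (ω - a)) =
      δ * (x * (ω - a) - Real.log (1 + x * (ω - a))) := by
    rw [hδdef, div_mul_cancel₀ _ hθ.ne']
  refine ⟨Real.log (1 + v * a) - y * a - δ * (Real.log (1 + b * a) - x * a), y - δ * x, δ,
    fun p hp hpω => ?_, by ring, ?_⟩
  · have h1 : 0 < 1 + y * (p - a) := by
      rw [hydef, key v p hv hp]; exact div_pos (one_add_mul_pos hv hp) hva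
    have := ratio_sub_log hx hxy hT hδ h1 (by linarith)
    rw [hxdef, hydef, klog b p hb hp, klog v p hv hp, ← hxdef, ← hydef] at this
    linarith
  · have hω : 0 ≤ ω := ha.trans haω.le
    have := hδ
    rw [hxdef, hydef, klog b ω hb hω, klog v ω hv hω, ← hxdef, ← hydef] at this
    linarith

/-! ### Points of `Ω` and the rate bounds on it. -/

variable {S : RelaySystem}

lemma v_pos (S : RelaySystem) : 0 < S.v :=
  div_pos (pow_pos (norm_pos_iff.2 S.h₂_ne) 2) S.N₀_pos

lemma β₀_pos (S : RelaySystem) : 0 < S.β₀ := div_pos S.β_pos S.N₀_pos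

lemma Pnorm_pos (S : RelaySystem) : 0 < S.Pnorm :=
  div_pos (mul_pos S.Pavg_pos (pow_pos (norm_pos_iff.2 S.h₁_ne) 2)) S.β_pos

lemma pavg_lt_pmax (hP : S.Pnorm < S.P0) : S.pavg < S.pmax := by
  have := S.Pnorm_pos
  unfold P0 at hP
  linarith

lemma V1_fst_pos (hP : S.Pnorm < S.P0) : 0 < S.V1.1 :=
  div_pos (mul_pos S.pmax_pos S.Pnorm_pos) (sub_pos.2 (pavg_lt_pmax hP))

lemma V1_fst_mul (hP : S.Pnorm < S.P0) : S.V1.1 * (S.pmax - S.pavg) = S.pmax * S.Pnorm :=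
  div_mul_cancel₀ _ (sub_pos.2 (pavg_lt_pmax hP)).ne'

lemma Pnorm_lt_V1_fst (hP : S.Pnorm < S.P0) : S.Pnorm < S.V1.1 := by
  have h := V1_fst_mul hP
  have h1 := S.pavg_pos
  have h2 := V1_fst_pos hP
  have h3 := S.pmax_pos
  nlinarith

lemma V1_fst_lt (hP : S.Pnorm < S.P0) : S.V1.1 < S.Pnorm + S.pavg := by
  have h := V1_fst_mul hP
  have h1 := S.pavg_pos
  have h4 := pavg_lt_pmax hP
  unfold P0 at hP
  nlinarith

lemma mem_Omega_iff (hP : S.Pnorm < S.P0) {ω F : ℝ} :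
    (ω, F) ∈ S.Omega ↔ S.V1.1 ≤ ω ∧ ω ≤ S.Pnorm + S.pavg ∧ S.Pnorm ≤ F * ω ∧
      F * (S.pmax - ω) ≤ S.pmax - S.pavg - S.Pnorm := by
  have h0 := V1_fst_pos hP
  unfold P0 at hP
  constructor
  · rintro ⟨h1, h2, h3, h4⟩
    simp only at h1 h2 h3 h4
    have hω : 0 < ω := h0.trans_le h1
    rw [div_le_iff₀ hω] at h3
    rw [le_div_iff₀ (by linarith)] at h4
    exact ⟨h1, h2, h3, h4⟩
  · rintro ⟨h1, h2, h3, h4⟩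
    have hω : 0 < ω := h0.trans_le h1
    refine ⟨h1, h2, ?_, ?_⟩
    · rwa [div_le_iff₀ hω]
    · rwa [le_div_iff₀ (by simp only; linarith)]

section Point

variable (hP : S.Pnorm < S.P0) {ω F : ℝ} (hx : (ω, F) ∈ S.Omega)
include hP hx

lemma Omega.V1_le : S.V1.1 ≤ ω := ((mem_Omega_iff hP).1 hx).1
lemma Omega.le_W : ω ≤ S.Pnorm + S.pavg := ((mem_Omega_iff hP).1 hx).2.1
lemma Omega.Pnorm_le : S.Pnorm ≤ F * ω := ((mem_Omega_iff hP).1 hx).2.2.1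
lemma Omega.upper : F * (S.pmax - ω) ≤ S.pmax - S.pavg - S.Pnorm :=
  ((mem_Omega_iff hP).1 hx).2.2.2

lemma Omega.pos : 0 < ω := (V1_fst_pos hP).trans_le (Omega.V1_le hP hx)

lemma Omega.lt_pmax : ω < S.pmax := by
  have := Omega.le_W hP hx
  unfold P0 at hP
  linarith

lemma Omega.Pnorm_lt : S.Pnorm < ω := (Pnorm_lt_V1_fst hP).trans_le (Omega.V1_le hP hx)

lemma Omega.F_pos : 0 < F := by
  have h1 := Omega.Pnorm_le hP hx
  have h2 := Omega.pos hP hx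
  have h3 := S.Pnorm_pos
  by_contra! h
  nlinarith

lemma Omega.F_le_one : F ≤ 1 := by
  have h1 := Omega.upper hP hx
  have h2 := Omega.lt_pmax hP hx
  have h3 := Omega.le_W hP hx
  by_contra! h
  nlinarith

lemma Omega.F_lt_one (h : ω < S.Pnorm + S.pavg) : F < 1 := by
  have h1 := Omega.upper hP hx
  have h2 := Omega.lt_pmax hP hx
  by_contra! h
  nlinarith

lemma Omega.mean_nonneg : 0 ≤ ω - S.Pnorm / F := by
  have h := (div_le_iff₀ (Omega.F_pos hP hx)).2
    ((Omega.Pnorm_le hP hx).trans_eq (mul_comm _ _))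
  linarith

lemma Omega.mean_lt : ω - S.Pnorm / F < ω := by
  have := div_pos S.Pnorm_pos (Omega.F_pos hP hx)
  linarith

lemma Omega.F_mul_mean : F * (ω - S.Pnorm / F) = F * ω - S.Pnorm := by
  have := (Omega.F_pos hP hx).ne'
  field_simp

/-- This survives the division by zero at `F = 1`: in `Ω` that value forces `ω = 𝒫 + p̄`, and both
sides vanish. -/
lemma Omega.mul_upperMean : (1 - F) * S.upperMean ω F = S.Pnorm + S.pavg - F * ω := by
  rcases eq_or_ne F 1 with h | h
  · have h1 : ¬ ω < S.Pnorm + S.pavg := fun h' => (Omega.F_lt_one hP hx h').ne h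
    have h2 := Omega.le_W hP hx
    rw [h]
    linarith
  · exact mul_div_cancel₀ _ (sub_ne_zero.2 h.symm)

lemma Omega.le_upperMean (h : F < 1) : ω ≤ S.upperMean ω F := by
  have := Omega.le_W hP hx
  rw [upperMean, le_div_iff₀ (sub_pos.2 h)]
  linarith

lemma Omega.upperMean_nonneg : 0 ≤ S.upperMean ω F := by
  rcases (Omega.F_le_one hP hx).lt_or_eq with h | h
  · exact (Omega.pos hP hx).le.trans (Omega.le_upperMean hP hx h)
  · simp [upperMean, h]

lemma Omega.upperMean_le : S.upperMean ω F ≤ S.pmax := by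
  rcases (Omega.F_le_one hP hx).lt_or_eq with h | h
  · have := Omega.upper hP hx
    rw [upperMean, div_le_iff₀ (sub_pos.2 h)]
    linarith
  · simp [upperMean, h, S.pmax_pos.le]

lemma R1min_eq : S.R1min ω F =
    F * (Real.log (1 + S.β₀ * ω) - Real.log (1 + S.β₀ * (ω - S.Pnorm / F))) := by
  have hF := Omega.F_pos hP hx
  have h1 := one_add_mul_pos S.β₀_pos (Omega.pos hP hx).le
  have h2 := one_add_mul_pos S.β₀_pos (Omega.mean_nonneg hP hx)
  rw [← Real.log_div h1.ne' h2.ne', R1min]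
  have e : F * (1 + ω * S.β₀) - S.Pnorm * S.β₀ = F * (1 + S.β₀ * (ω - S.Pnorm / F)) := by
    field_simp
    ring
  rw [e, mul_div_mul_left _ _ hF.ne', mul_comm ω]

lemma R1min_le_R1max : S.R1min ω F ≤ S.R1max ω := by
  have h1 := Omega.F_pos hP hx
  have h0 := Omega.pos hP hx
  have h2 := chord_log S.β₀_pos (Omega.mean_nonneg hP hx) (Omega.mean_lt hP hx).le
  have h3 := mul_le_mul_of_nonneg_left h2 h1.le
  have e := Omega.F_mul_mean hP hx
  rw [← mul_assoc, e] at h3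
  rw [R1min_eq hP hx, R1max, div_mul_eq_mul_div, le_div_iff₀ h0]
  linarith

lemma R1min_lt_R1max (ha : 0 < ω - S.Pnorm / F) : S.R1min ω F < S.R1max ω := by
  have h1 := Omega.F_pos hP hx
  have h0 := Omega.pos hP hx
  have h2 := chord_log_lt S.β₀_pos ha (Omega.mean_lt hP hx)
  have h3 := mul_lt_mul_of_pos_left h2 h1
  have e := Omega.F_mul_mean hP hx
  rw [← mul_assoc, e] at h3
  rw [R1min_eq hP hx, R1max, div_mul_eq_mul_div, lt_div_iff₀ h0]
  linarith

lemma F_sub_nonneg : 0 ≤ F - S.Pnorm / ω := by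
  have := (div_le_iff₀ (Omega.pos hP hx)).2 (Omega.Pnorm_le hP hx)
  linarith

lemma F_sub_mul : (F - S.Pnorm / ω) * ω = F * ω - S.Pnorm := by
  have := (Omega.pos hP hx).ne'
  field_simp

lemma R2min_le_R2max : S.R2min ω F ≤ S.R2max ω F := by
  have h0 := Omega.pos hP hx
  have h := merge_log (k := S.v) (s := F - S.Pnorm / ω) (t := S.Pnorm / ω) (x := ω) (y := 0)
    (u := F) (z := ω - S.Pnorm / F) S.v_pos (F_sub_nonneg hP hx)
    (div_nonneg S.Pnorm_pos.le h0.le) h0.le le_rfl (by ring)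
    (by rw [F_sub_mul hP hx, Omega.F_mul_mean hP hx]; ring)
  simp only [mul_zero, add_zero, Real.log_one] at h
  unfold R2min R2max
  linarith

lemma R1max_le_V1 : S.R1max ω ≤ S.R1max S.V1.1 := by
  have h1 := V1_fst_pos hP
  have h2 := Omega.V1_le hP hx
  have h := chord_log S.β₀_pos h1.le h2
  have h3 := mul_le_mul_of_nonneg_left h S.Pnorm_pos.le
  rw [R1max, R1max, div_mul_eq_mul_div, div_mul_eq_mul_div,
    div_le_div_iff₀ (Omega.pos hP hx) h1]
  linarith

lemma R1max_W_le : S.R1max (S.Pnorm + S.pavg) ≤ S.R1max ω := by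
  have h1 := Omega.pos hP hx
  have h2 := Omega.le_W hP hx
  have h := chord_log S.β₀_pos h1.le h2
  have h3 := mul_le_mul_of_nonneg_left h S.Pnorm_pos.le
  rw [R1max, R1max, div_mul_eq_mul_div, div_mul_eq_mul_div,
    div_le_div_iff₀ (h1.trans_le h2) h1]
  linarith

/-- `R2min` is the second-hop rate of masses at `0`, `ω` and `upperMean ω F` with mean `p̄`; the
chord of the logarithm over `[0, pmax]` bounds it below. -/
lemma le_R2min : S.pavg / S.pmax * Real.log (1 + S.v * S.pmax) ≤ S.R2min ω F := by
  have hM := S.pmax_pos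
  have h0 := Omega.pos hP hx
  have h1 := chord_log S.v_pos h0.le (Omega.lt_pmax hP hx).le
  have h2 := chord_log S.v_pos (Omega.upperMean_nonneg hP hx) (Omega.upperMean_le hP hx)
  have h3 := mul_le_mul_of_nonneg_left h1 (F_sub_nonneg hP hx)
  have h4 := mul_le_mul_of_nonneg_left h2 (sub_nonneg.2 (Omega.F_le_one hP hx))
  rw [← mul_assoc, F_sub_mul hP hx] at h3
  rw [← mul_assoc, Omega.mul_upperMean hP hx] at h4
  rw [div_mul_eq_mul_div, div_le_iff₀ hM, R2min]
  linarith

lemma R2max_le : S.R2max ω F ≤ Real.log (1 + S.v * S.pavg) := by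
  have h := merge_log (k := S.v) (u := 1) (z := S.pavg) S.v_pos (Omega.F_pos hP hx).le
    (sub_nonneg.2 (Omega.F_le_one hP hx)) (Omega.mean_nonneg hP hx)
    (Omega.upperMean_nonneg hP hx) (by ring)
    (by rw [Omega.mul_upperMean hP hx, Omega.F_mul_mean hP hx]; ring)
  rw [R2max]
  linarith

lemma R2min_le : S.R2min ω F ≤
    S.pavg / (S.Pnorm + S.pavg) * Real.log (1 + S.v * (S.Pnorm + S.pavg)) := by
  have hp := S.pavg_pos
  have hPp := S.Pnorm_pos
  have h0 := Omega.pos hP hx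
  have h1 := Omega.Pnorm_lt hP hx
  have hd : 0 < ω - S.Pnorm := sub_pos.2 h1
  -- Mean of the mass not at `0`: weight `1 - 𝒫 / ω` and overall mean `p̄`. The masses at `ω` and
  -- above merge there; then `z ≥ 𝒫 + p̄`, which is `ω ≤ 𝒫 + p̄` rearranged, and the chord ratio
  -- `log (1 + v z) / z` decreases in `z`.
  set z := S.pavg * ω / (ω - S.Pnorm) with hz
  have hz' : z * (ω - S.Pnorm) = S.pavg * ω := div_mul_cancel₀ _ hd.ne'
  have h := merge_log (k := S.v) (u := 1 - S.Pnorm / ω) (z := z) S.v_pos (F_sub_nonneg hP hx)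
    (sub_nonneg.2 (Omega.F_le_one hP hx)) h0.le
    (Omega.upperMean_nonneg hP hx) (by ring)
    (by rw [Omega.mul_upperMean hP hx, F_sub_mul hP hx]; field_simp; linarith)
  have hWz : S.Pnorm + S.pavg ≤ z := by
    have := Omega.le_W hP hx
    rw [hz, le_div_iff₀ hd]
    nlinarith
  have hW : 0 < S.Pnorm + S.pavg := by positivity
  have h2 := chord_log S.v_pos hW.le hWz
  have hzp : 0 < z := hW.trans_le hWz
  have e : 1 - S.Pnorm / ω = S.pavg / z := by
    rw [hz]; field_simp
  rw [e] at h
  refine (show S.R2min ω F ≤ _ from h).trans ?_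
  rw [div_mul_eq_mul_div, div_mul_eq_mul_div, div_le_div_iff₀ hzp hW]
  have := mul_le_mul_of_nonneg_left h2 hp.le
  linarith

/-- Lowering the water level at fixed `F` raises `R1min`. -/
lemma R1min_antitone_left {ω' : ℝ} (hx' : (ω', F) ∈ S.Omega) (h : ω ≤ ω') :
    S.R1min ω' F ≤ S.R1min ω F := by
  have hF := Omega.F_pos hP hx
  have hb := S.β₀_pos
  have h1 := one_add_mul_pos hb (Omega.pos hP hx).le
  have h2 := one_add_mul_pos hb (Omega.mean_nonneg hP hx)
  have h1' := one_add_mul_pos hb (Omega.pos hP hx').le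
  have h2' := one_add_mul_pos hb (Omega.mean_nonneg hP hx')
  rw [R1min_eq hP hx, R1min_eq hP hx', ← Real.log_div h1.ne' h2.ne', ← Real.log_div h1'.ne' h2'.ne']
  refine mul_le_mul_of_nonneg_left (Real.log_le_log (div_pos h1' h2') ?_) hF.le
  rw [div_le_div_iff₀ h2' h2]
  have hc : 0 ≤ S.Pnorm / F := div_nonneg S.Pnorm_pos.le hF.le
  have : 0 ≤ (S.β₀ * S.β₀) * ((ω' - ω) * (S.Pnorm / F)) :=
    mul_nonneg (mul_nonneg hb.le hb.le) (mul_nonneg (sub_nonneg.2 h) hc)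
  nlinarith

/-- Lowering `F` at fixed water level raises `R1min`. -/
lemma R1min_antitone_right {F' : ℝ} (hx' : (ω, F') ∈ S.Omega) (h : F ≤ F') :
    S.R1min ω F' ≤ S.R1min ω F := by
  -- The lower mean for `F'` is the barycenter of mass `F` at the old mean and mass `F' - F` at `ω`.
  have hm := merge_log (k := S.β₀) (s := F) (t := F' - F) (u := F') (x := ω - S.Pnorm / F)
    (y := ω) (z := ω - S.Pnorm / F') S.β₀_pos (Omega.F_pos hP hx).le (sub_nonneg.2 h)
    (Omega.mean_nonneg hP hx) (Omega.pos hP hx).le (by ring)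
    (by rw [Omega.F_mul_mean hP hx, Omega.F_mul_mean hP hx']; ring)
  rw [R1min_eq hP hx, R1min_eq hP hx']
  linarith

/-- Raising the water level at fixed `F` raises `R2max`. -/
lemma R2max_monotone_left {ω' : ℝ} (hx' : (ω', F) ∈ S.Omega) (h : ω ≤ ω') :
    S.R2max ω F ≤ S.R2max ω' F := by
  rcases (Omega.F_le_one hP hx).lt_or_eq with hF | hF
  -- With `F` fixed, raising `ω` moves the lower point up and the upper point down, keeping the
  -- overall mean `p̄`.
  · refine contract_log S.v_pos (Omega.F_pos hP hx).le hF.le (Omega.mean_nonneg hP hx)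
      (by linarith) ((Omega.mean_lt hP hx').le.trans (Omega.le_upperMean hP hx' hF)) ?_ ?_
    · have := mul_le_mul_of_nonneg_left h (Omega.F_pos hP hx).le
      rw [upperMean, upperMean]
      exact div_le_div_of_nonneg_right (by linarith) (sub_pos.2 hF).le
    · rw [Omega.mul_upperMean hP hx, Omega.mul_upperMean hP hx', Omega.F_mul_mean hP hx,
        Omega.F_mul_mean hP hx']
      ring
  · have e : ω' = ω := by
      refine le_antisymm ((Omega.le_W hP hx').trans ?_) h
      by_contra! hc
      exact (Omega.F_lt_one hP hx hc).ne hF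
    rw [e]

/-- Right of a point of `Omega` up to the line `ω = 𝒫 + p̄` we stay in `Omega`. -/
lemma Omega.move_right {ω' : ℝ} (h : ω ≤ ω') (h' : ω' ≤ S.Pnorm + S.pavg) :
    (ω', F) ∈ S.Omega := by
  have hF := Omega.F_pos hP hx
  refine (mem_Omega_iff hP).2 ⟨(Omega.V1_le hP hx).trans h, h', ?_, ?_⟩
  · exact (Omega.Pnorm_le hP hx).trans (mul_le_mul_of_nonneg_left h hF.le)
  · exact (mul_le_mul_of_nonneg_left (by linarith) hF.le).trans (Omega.upper hP hx)

/-- Below a point of `Omega` down to the curve `F ω = 𝒫` we stay in `Omega`. -/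
lemma Omega.move_down {F' : ℝ} (h : F' ≤ F) (h' : S.Pnorm / ω ≤ F') :
    (ω, F') ∈ S.Omega := by
  refine (mem_Omega_iff hP).2 ⟨Omega.V1_le hP hx, Omega.le_W hP hx, ?_, ?_⟩
  · exact (div_le_iff₀ (Omega.pos hP hx)).1 h'
  · exact (mul_le_mul_of_nonneg_right h (sub_pos.2 (Omega.lt_pmax hP hx)).le).trans
      (Omega.upper hP hx)

end Point

/-! ### Boundary curves and vertices of `Ω`. -/

lemma R2max_lower {ω : ℝ} : S.R2max ω (S.Pnorm / ω) = S.R2min ω (S.Pnorm / ω) := by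
  rw [R2max, R2min, div_div_cancel₀ S.Pnorm_pos.ne']
  simp

lemma R2min_V3 : S.R2min S.V3.1 S.V3.2 =
    S.pavg / (S.Pnorm + S.pavg) * Real.log (1 + S.v * (S.Pnorm + S.pavg)) := by
  have h0 : 0 < S.Pnorm + S.pavg := add_pos S.Pnorm_pos S.pavg_pos
  have h1 := S.pavg_pos
  have e : 1 - S.Pnorm / (S.Pnorm + S.pavg) = S.pavg / (S.Pnorm + S.pavg) := by
    field_simp; ring
  change (S.Pnorm / (S.Pnorm + S.pavg) - S.Pnorm / (S.Pnorm + S.pavg)) * _ +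
    (1 - S.Pnorm / (S.Pnorm + S.pavg)) * Real.log (1 + S.v *
      ((S.Pnorm + S.pavg - S.Pnorm / (S.Pnorm + S.pavg) * (S.Pnorm + S.pavg)) /
        (1 - S.Pnorm / (S.Pnorm + S.pavg)))) = _
  rw [e, div_mul_cancel₀ _ h0.ne', add_sub_cancel_left, div_div_cancel₀ h1.ne']
  ring

section Boundary

variable (hP : S.Pnorm < S.P0)
include hP

lemma lower_mem {ω : ℝ} (h : S.V1.1 ≤ ω) (h' : ω ≤ S.Pnorm + S.pavg) :
    (ω, S.Pnorm / ω) ∈ S.Omega := by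
  have h0 := (V1_fst_pos hP).trans_le h
  have h1 := V1_fst_mul hP
  have h2 := pavg_lt_pmax hP
  refine (mem_Omega_iff hP).2 ⟨h, h', (div_mul_cancel₀ _ h0.ne').ge, ?_⟩
  rw [div_mul_eq_mul_div, div_le_iff₀ h0]
  nlinarith

lemma upper_mem {ω : ℝ} (h : S.V1.1 ≤ ω) (h' : ω ≤ S.Pnorm + S.pavg) :
    (ω, (S.pmax - S.pavg - S.Pnorm) / (S.pmax - ω)) ∈ S.Omega := by
  have h0 := (V1_fst_pos hP).trans_le h
  have h1 := V1_fst_mul hP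
  have h2 := pavg_lt_pmax hP
  have h3 : 0 < S.pmax - ω := by unfold P0 at hP; linarith
  refine (mem_Omega_iff hP).2 ⟨h, h', ?_, (div_mul_cancel₀ _ h3.ne').le⟩
  rw [div_mul_eq_mul_div, le_div_iff₀ h3]
  nlinarith

lemma V1_snd : S.V1.2 = S.Pnorm / S.V1.1 := by
  have h1 := V1_fst_mul hP
  have h2 := V1_fst_pos hP
  have h3 := S.pmax_pos
  change 1 - S.pavg / S.pmax = _
  rw [eq_div_iff h2.ne']
  field_simp
  linarith

lemma V1_mem : (S.V1.1, S.V1.2) ∈ S.Omega := by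
  rw [V1_snd hP]
  exact lower_mem hP le_rfl (V1_fst_lt hP).le

lemma V3_mem : (S.V3.1, S.V3.2) ∈ S.Omega := lower_mem hP (V1_fst_lt hP).le le_rfl

lemma right_mem {F : ℝ} (h : S.Pnorm / (S.Pnorm + S.pavg) ≤ F) (h' : F ≤ 1) :
    (S.Pnorm + S.pavg, F) ∈ S.Omega := by
  have h0 : 0 < S.Pnorm + S.pavg := add_pos S.Pnorm_pos S.pavg_pos
  refine (mem_Omega_iff hP).2 ⟨(V1_fst_lt hP).le, le_rfl, (div_le_iff₀ h0).1 h, ?_⟩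
  unfold P0 at hP
  nlinarith

lemma V2_mem : (S.V2.1, S.V2.2) ∈ S.Omega := by
  refine right_mem hP ?_ le_rfl
  have h0 : 0 < S.Pnorm + S.pavg := add_pos S.Pnorm_pos S.pavg_pos
  exact (div_le_one h0).2 (by linarith [S.pavg_pos])

lemma R1min_lower {ω : ℝ} (h : S.V1.1 ≤ ω) (h' : ω ≤ S.Pnorm + S.pavg) :
    S.R1min ω (S.Pnorm / ω) = S.R1max ω := by
  have h0 := (V1_fst_pos hP).trans_le h
  rw [R1min_eq hP (lower_mem hP h h'), R1max, div_div_cancel₀ S.Pnorm_pos.ne']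
  simp

/-- On the lower boundary `F ω = 𝒫` the inner mean is `0`, so the best and worst values of each hop
coincide. Both `V1` and `V3` lie there. -/
lemma Q1_lower {ω : ℝ} (h : S.V1.1 ≤ ω) (h' : ω ≤ S.Pnorm + S.pavg) :
    S.Q1 ω (S.Pnorm / ω) = -S.Q2 ω (S.Pnorm / ω) := by
  rw [Q1, Q2, R1min_lower hP h h', R2max_lower]
  ring

lemma Q1_V1 : S.Q1 S.V1.1 S.V1.2 = -S.Q2 S.V1.1 S.V1.2 := by
  rw [V1_snd hP]
  exact Q1_lower hP le_rfl (V1_fst_lt hP).le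

lemma Q1_V3 : S.Q1 S.V3.1 S.V3.2 = -S.Q2 S.V3.1 S.V3.2 :=
  Q1_lower hP (V1_fst_lt hP).le le_rfl

lemma upperMean_V1 : S.upperMean S.V1.1 S.V1.2 = S.pmax := by
  have h1 := V1_fst_pos hP
  have e : S.V1.2 * S.V1.1 = S.Pnorm := by rw [V1_snd hP, div_mul_cancel₀ _ h1.ne']
  have e2 : 1 - S.V1.2 = S.pavg / S.pmax := by change 1 - (1 - S.pavg / S.pmax) = _; ring
  rw [upperMean, e, e2, add_sub_cancel_left, div_div_cancel₀ S.pavg_pos.ne']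

lemma R2min_V1 : S.R2min S.V1.1 S.V1.2 = S.pavg / S.pmax * Real.log (1 + S.v * S.pmax) := by
  rw [R2min, upperMean_V1 hP, ← V1_snd hP]
  change (S.V1.2 - S.V1.2) * _ + (1 - (1 - S.pavg / S.pmax)) * _ = _
  ring

lemma Q2_V1 : S.Q2 S.V1.1 S.V1.2 = S.pavg / S.pmax * Real.log (1 + S.v * S.pmax) -
    (1 - S.pavg / S.pmax) * Real.log (1 + S.β₀ * S.V1.1) := by
  rw [Q2, R2min_V1 hP, R1max, ← V1_snd hP]
  rfl

lemma Q1_V2 : S.Q1 S.V2.1 S.V2.2 = Real.log (1 + S.β₀ * (S.Pnorm + S.pavg)) -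
    Real.log (1 + S.β₀ * S.pavg) - Real.log (1 + S.v * S.pavg) := by
  rw [Q1, R1min_eq hP (V2_mem hP), R2max]
  simp [V2]

lemma Q1_V3_eq : S.Q1 S.V3.1 S.V3.2 = (S.Pnorm * Real.log (1 + (S.Pnorm + S.pavg) * S.β₀) -
    S.pavg * Real.log (1 + S.v * (S.Pnorm + S.pavg))) / (S.Pnorm + S.pavg) := by
  rw [Q1_V3 hP, Q2, R2min_V3]
  change -(_ - S.Pnorm / (S.Pnorm + S.pavg) * Real.log (1 + S.β₀ * (S.Pnorm + S.pavg))) = _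
  rw [mul_comm S.β₀]
  ring

lemma le_P3_iff : S.Pnorm ≤ S.P3 ↔ 0 ≤ S.Q2 S.V1.1 S.V1.2 := by
  have hM := S.pmax_pos
  have hp := S.pavg_pos
  have hb := S.β₀_pos
  have hd := sub_pos.2 (pavg_lt_pmax hP)
  have hv := one_add_mul_pos S.v_pos hM.le
  have hω := one_add_mul_pos hb (V1_fst_pos hP).le
  have h1 : 0 ≤ S.Q2 S.V1.1 S.V1.2 ↔ Real.log (1 + S.β₀ * S.V1.1) ≤
      Real.log ((1 + S.pmax * S.v) ^ (S.pavg / (S.pmax - S.pavg))) := by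
    rw [mul_comm S.pmax, Real.log_rpow hv, Q2_V1 hP, sub_nonneg, one_sub_div hM.ne',
      div_mul_eq_mul_div, div_mul_eq_mul_div, div_le_div_iff_of_pos_right hM,
      div_mul_eq_mul_div, le_div_iff₀ hd, mul_comm (S.pmax - S.pavg)]
  rw [h1, Real.log_le_log_iff hω (Real.rpow_pos_of_pos (by rwa [mul_comm]) _), P3]
  set X := (1 + S.pmax * S.v) ^ (S.pavg / (S.pmax - S.pavg))
  rw [div_mul_eq_mul_div, le_div_iff₀ (mul_pos hM hb)]
  change _ ↔ 1 + S.β₀ * (S.pmax * S.Pnorm / (S.pmax - S.pavg)) ≤ X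
  rw [← le_sub_iff_add_le', ← mul_div_assoc, div_le_iff₀ hd]
  constructor <;> intro h <;> linarith

lemma P2_le_iff : S.P2 ≤ S.Pnorm ↔ 0 ≤ S.Q1 S.V2.1 S.V2.2 := by
  have hp := S.pavg_pos
  have hb := S.β₀_pos
  have h1 := one_add_mul_pos S.v_pos hp.le
  have h2 := one_add_mul_pos hb hp.le
  have h3 := one_add_mul_pos hb (add_pos S.Pnorm_pos hp).le
  rw [Q1_V2 hP, sub_sub, sub_nonneg, ← Real.log_mul h2.ne' h1.ne',
    Real.log_le_log_iff (mul_pos h2 h1) h3, P2, div_mul_eq_mul_div, div_le_iff₀ hb]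
  constructor <;> intro h <;> linarith

/-- Going right to `ω = 𝒫 + p̄` and then up to `F = 1` only lowers `R1min`, while at `V2` the rate
`R2max` attains its Jensen bound. -/
lemma Q1_V2_le {ω F : ℝ} (hx : (ω, F) ∈ S.Omega) : S.Q1 S.V2.1 S.V2.2 ≤ S.Q1 ω F := by
  have hx' := Omega.move_right hP hx (Omega.le_W hP hx) le_rfl
  have h1 := R1min_antitone_left hP hx hx' (Omega.le_W hP hx)
  have h2 := R1min_antitone_right hP hx' (V2_mem hP) (Omega.F_le_one hP hx)
  have h3 := R2max_le hP hx
  have h4 : S.R2max S.V2.1 S.V2.2 = Real.log (1 + S.v * S.pavg) := by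
    simp [R2max, V2]
  rw [Q1, Q1, h4]
  have h5 : S.R1min S.V2.1 S.V2.2 ≤ S.R1min ω F := h2.trans h1
  linarith

lemma Q2_V1_le {ω F : ℝ} (hx : (ω, F) ∈ S.Omega) : S.Q2 S.V1.1 S.V1.2 ≤ S.Q2 ω F := by
  have h1 := R1max_le_V1 hP hx
  have h2 := le_R2min hP hx
  rw [← R2min_V1 hP] at h2
  rw [Q2, Q2]
  linarith

/-- `Q1 ≤ -Q2` throughout `Ω`, with equality at `V1`, where `Q2` is least. -/
lemma Q1_le_V1 {ω F : ℝ} (hx : (ω, F) ∈ S.Omega) : S.Q1 ω F ≤ S.Q1 S.V1.1 S.V1.2 := by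
  have h1 := R1min_le_R1max hP hx
  have h2 := R2min_le_R2max hP hx
  have h3 := Q2_V1_le hP hx
  rw [Q1_V1 hP]
  rw [Q1]
  unfold Q2 at h3 ⊢
  linarith

lemma Q2_le_V3 {ω F : ℝ} (hx : (ω, F) ∈ S.Omega) : S.Q2 ω F ≤ S.Q2 S.V3.1 S.V3.2 := by
  have h1 := R1max_W_le hP hx
  have h2 := R2min_le hP hx
  rw [← R2min_V3] at h2
  rw [Q2, Q2]
  change _ ≤ _ - S.R1max (S.Pnorm + S.pavg)
  linarith

end Boundary

/-! ### The fourth threshold -/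

/-- After division by `x + p̄`, the left side of the inequality is nonincreasing in `x` (chord slope
of a concave function), and the right side, `x / (x + p̄)` times an increasing logarithm, is
strictly increasing. So the two sides cross at most once. -/
lemma P4Ineq_strict {x y : ℝ} (hx : 0 < x) (hxy : x < y) (h : S.P4Ineq x) :
    S.pavg * Real.log (1 + S.v * (y + S.pavg)) < y * Real.log (1 + (y + S.pavg) * S.β₀) := by
  have hp := S.pavg_pos
  have hb := S.β₀_pos
  unfold P4Ineq at h
  rw [mul_comm _ S.β₀] at h ⊢
  have hX : 0 < x + S.pavg := by linarith
  have hXY : x + S.pavg < y + S.pavg := by linarith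
  have h1 := chord_log S.v_pos hX.le hXY.le
  have h2 : Real.log (1 + S.β₀ * (x + S.pavg)) < Real.log (1 + S.β₀ * (y + S.pavg)) :=
    Real.log_lt_log (one_add_mul_pos hb hX.le)
      (by have := mul_lt_mul_of_pos_left hXY hb; linarith)
  have h0 := log_one_add_mul_pos hb hX
  have h3 := mul_le_mul_of_nonneg_left h1 hp.le
  have h4 := mul_le_mul_of_nonneg_left h (hX.trans hXY).le
  have h5 : (y + S.pavg) * (x * Real.log (1 + S.β₀ * (x + S.pavg))) ≤
      (x + S.pavg) * (y * Real.log (1 + S.β₀ * (x + S.pavg))) := by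
    have := mul_nonneg (mul_nonneg (sub_pos.2 hxy).le hp.le) h0.le
    linarith
  have h6 : (x + S.pavg) * (y * Real.log (1 + S.β₀ * (x + S.pavg))) <
      (x + S.pavg) * (y * Real.log (1 + S.β₀ * (y + S.pavg))) := by
    have := hx.trans hxy
    gcongr
  refine lt_of_mul_lt_mul_left ?_ hX.le
  linarith

lemma exists_P4_root (S : RelaySystem) : ∃ r : ℝ, 0 < r ∧
    S.pavg * Real.log (1 + S.v * (r + S.pavg)) = r * Real.log (1 + (r + S.pavg) * S.β₀) := by
  have hp := S.pavg_pos
  have hb := S.β₀_pos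
  have hv := S.v_pos
  -- The exponential makes the right-hand logarithm at least `2 p̄ v`, and `p̄ ≤ K` gives `log (1 +
  -- v (K + p̄)) ≤ 2 v K`; so the inequality holds at `K`.
  set K := max S.pavg (Real.exp (2 * S.pavg * S.v) / S.β₀) with hK
  have hK0 : 0 < K := hp.trans_le (le_max_left _ _)
  set h : ℝ → ℝ := fun x => x * Real.log (1 + (x + S.pavg) * S.β₀) -
    S.pavg * Real.log (1 + S.v * (x + S.pavg)) with hh
  have hcont : ContinuousOn h (Icc 0 K) := by
    refine ContinuousOn.sub (continuousOn_id.mul (ContinuousOn.log (by fun_prop) ?_))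
      (continuousOn_const.mul (ContinuousOn.log (by fun_prop) ?_))
    · intro x hx
      have := hx.1
      positivity
    · intro x hx
      have := hx.1
      positivity
  have h0 : h 0 < 0 := by
    have := mul_pos hp (log_one_add_mul_pos hv hp)
    simp only [hh, zero_mul, zero_add]
    linarith
  have h1 : 0 ≤ h K := by
    have hX : 0 ≤ K + S.pavg := by positivity
    have e1 : Real.log (1 + S.v * (K + S.pavg)) ≤ S.v * (K + S.pavg) := by
      have := Real.log_le_sub_one_of_pos (one_add_mul_pos hv hX)
      linarith
    have e2 : 2 * S.pavg * S.v ≤ Real.log (1 + (K + S.pavg) * S.β₀) := by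
      rw [Real.le_log_iff_exp_le (by positivity)]
      have := (div_le_iff₀ hb).1 (le_max_right S.pavg (Real.exp (2 * S.pavg * S.v) / S.β₀))
      rw [← hK] at this
      have := mul_pos hp hb
      linarith
    have e3 : S.pavg ≤ K := le_max_left _ _
    have e4 := mul_le_mul_of_nonneg_left e1 hp.le
    have e5 := mul_le_mul_of_nonneg_left e2 hK0.le
    have e6 := mul_le_mul_of_nonneg_left e3 (mul_pos hp hv).le
    simp only [hh]
    linarith
  obtain ⟨r, hr, hr0⟩ := intermediate_value_Icc hK0.le hcont ⟨h0.le, h1⟩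
  refine ⟨r, lt_of_le_of_ne hr.1 ?_, ?_⟩
  · rintro rfl
    linarith
  · simp only [hh] at hr0
    linarith

lemma P4_spec (S : RelaySystem) : 0 < S.P4 ∧
    S.pavg * Real.log (1 + S.v * (S.P4 + S.pavg)) =
      S.P4 * Real.log (1 + (S.P4 + S.pavg) * S.β₀) ∧
    ∀ x : ℝ, 0 < x → (S.P4Ineq x ↔ S.P4 ≤ x) := by
  obtain ⟨r, hr, he⟩ := exists_P4_root S
  have key : ∀ x : ℝ, 0 < x → (S.P4Ineq x ↔ r ≤ x) := by
    intro x hx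
    constructor
    · intro h
      by_contra! hc
      exact (P4Ineq_strict hx hc h).ne he
    · intro h
      rcases h.eq_or_lt with rfl | h
      · exact he.le
      · exact (P4Ineq_strict hr h he.le).le
  have e : S.P4 = r := by
    have : {x | 0 < x ∧ S.P4Ineq x} = Ici r := by
      ext x
      exact ⟨fun h => (key x h.1).1 h.2, fun h => ⟨hr.trans_le h, (key x (hr.trans_le h)).2 h⟩⟩
    rw [P4, this, csInf_Ici]
  rw [e]
  exact ⟨hr, he, key⟩

lemma P4_le_iff (hP : S.Pnorm < S.P0) : S.P4 ≤ S.Pnorm ↔ 0 ≤ S.Q1 S.V3.1 S.V3.2 := by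
  have h0 : 0 < S.Pnorm + S.pavg := add_pos S.Pnorm_pos S.pavg_pos
  rw [← (P4_spec S).2.2 _ S.Pnorm_pos, Q1_V3_eq hP, le_div_iff₀ h0, zero_mul, sub_nonneg]
  rfl

lemma le_P4_iff (hP : S.Pnorm < S.P0) : S.Pnorm ≤ S.P4 ↔ 0 ≤ S.Q2 S.V3.1 S.V3.2 := by
  have h0 : 0 < S.Pnorm + S.pavg := add_pos S.Pnorm_pos S.pavg_pos
  have e := Q1_V3 hP
  rw [Q1_V3_eq hP] at e
  have e1 : 0 ≤ S.Q2 S.V3.1 S.V3.2 ↔ S.Pnorm * Real.log (1 + (S.Pnorm + S.pavg) * S.β₀) -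
    S.pavg * Real.log (1 + S.v * (S.Pnorm + S.pavg)) ≤ 0 := by
    rw [← neg_nonpos, ← e, div_le_iff₀ h0, zero_mul]
  rw [e1, sub_nonpos]
  constructor
  · intro h
    rcases h.eq_or_lt with h | h
    · rw [h]; exact (P4_spec S).2.1.ge
    · have := ((P4_spec S).2.2 _ S.Pnorm_pos).not.2 (not_le.2 h)
      exact (not_le.1 this).le
  · intro h
    by_contra! hc
    exact absurd h (not_le.2 (P4Ineq_strict (P4_spec S).1 hc (P4_spec S).2.1.le))

/-! ### Continuity and compactness -/

lemma mem_Omega3_iff {ω F : ℝ} (hx : (ω, F) ∈ S.Omega) :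
    (ω, F) ∈ S.Omega3 ↔ S.Q1 ω F < 0 ∧ S.Q2 ω F < 0 := by
  simp only [Omega3, Omega1, Omega2, mem_sdiff, mem_union, mem_ofPred_eq, hx, true_and, not_or,
    not_le, Q1, Q2, sub_neg]

section Continuity

variable (hP : S.Pnorm < S.P0)
include hP

lemma isCompact_Omega : IsCompact S.Omega := by
  have hsub : S.Omega ⊆ Icc S.V1.1 (S.Pnorm + S.pavg) ×ˢ Icc 0 1 := by
    rintro ⟨ω, F⟩ hx
    exact ⟨⟨Omega.V1_le hP hx, Omega.le_W hP hx⟩, (Omega.F_pos hP hx).le, Omega.F_le_one hP hx⟩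
  -- With denominators cleared, the constraints are polynomial and define closed sets.
  have he : S.Omega = {x | S.V1.1 ≤ x.1} ∩ ({x | x.1 ≤ S.Pnorm + S.pavg} ∩
      ({x | S.Pnorm ≤ x.2 * x.1} ∩ {x | x.2 * (S.pmax - x.1) ≤ S.pmax - S.pavg - S.Pnorm})) := by
    ext ⟨ω, F⟩
    exact mem_Omega_iff hP
  have hcl : IsClosed S.Omega := by
    rw [he]
    refine (isClosed_le ?_ ?_).inter ((isClosed_le ?_ ?_).inter
      ((isClosed_le ?_ ?_).inter (isClosed_le ?_ ?_))) <;> fun_prop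
  exact (isCompact_Icc.prod isCompact_Icc).of_isClosed_subset hcl hsub

lemma continuousOn_R1min : ContinuousOn (fun x : ℝ × ℝ => S.R1min x.1 x.2) S.Omega := by
  have : ContinuousOn (fun x : ℝ × ℝ => x.2 * (Real.log (1 + S.β₀ * x.1) -
      Real.log (1 + S.β₀ * (x.1 - S.Pnorm / x.2)))) S.Omega := by
    refine continuousOn_snd.mul (ContinuousOn.sub (ContinuousOn.log (by fun_prop) ?_)
      (ContinuousOn.log (continuousOn_const.add (continuousOn_const.mul (continuousOn_fst.sub
        (continuousOn_const.div continuousOn_snd ?_)))) ?_))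
    · rintro ⟨ω, F⟩ hx
      exact (one_add_mul_pos S.β₀_pos (Omega.pos hP hx).le).ne'
    · rintro ⟨ω, F⟩ hx
      exact (Omega.F_pos hP hx).ne'
    · rintro ⟨ω, F⟩ hx
      exact (one_add_mul_pos S.β₀_pos (Omega.mean_nonneg hP hx)).ne'
  exact this.congr fun x hx => R1min_eq hP hx

/-- The only delicate point is `F = 1`, where `upperMean` divides by zero. As it stays in `[0,
pmax]`, the factor `1 - F` squeezes the product to `0`. -/
lemma continuousOn_upper_rate : ContinuousOn
    (fun x : ℝ × ℝ => (1 - x.2) * Real.log (1 + S.v * S.upperMean x.1 x.2)) S.Omega := by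
  rintro ⟨ω, F⟩ hx
  rcases eq_or_ne F 1 with h | h
  · have h0 : Filter.Tendsto (fun x : ℝ × ℝ => (1 - x.2) * Real.log (1 + S.v * S.pmax))
        (nhdsWithin (ω, F) S.Omega) (nhds 0) := by
      have : Continuous fun x : ℝ × ℝ => (1 - x.2) * Real.log (1 + S.v * S.pmax) := by fun_prop
      have := this.continuousWithinAt (s := S.Omega) (x := (ω, F))
      simpa [ContinuousWithinAt, h] using this
    have hz : (1 - F) * Real.log (1 + S.v * S.upperMean ω F) = 0 := by simp [h]
    rw [ContinuousWithinAt, hz]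
    refine tendsto_of_tendsto_of_tendsto_of_le_of_le' tendsto_const_nhds h0 ?_ ?_
    · filter_upwards [self_mem_nhdsWithin] with x hx
      exact mul_nonneg (sub_nonneg.2 (Omega.F_le_one hP hx))
        (log_one_add_mul_nonneg S.v_pos (Omega.upperMean_nonneg hP hx))
    · filter_upwards [self_mem_nhdsWithin] with x hx
      exact mul_le_mul_of_nonneg_left (log_one_add_mul_mono S.v_pos
        (Omega.upperMean_nonneg hP hx) (Omega.upperMean_le hP hx))
        (sub_nonneg.2 (Omega.F_le_one hP hx))
  · have h1 : (1 : ℝ) - F ≠ 0 := sub_ne_zero.2 h.symm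
    have h2 : (1 : ℝ) + S.v * ((S.Pnorm + S.pavg - F * ω) / (1 - F)) ≠ 0 :=
      (one_add_mul_pos S.v_pos (Omega.upperMean_nonneg hP hx)).ne'
    refine ContinuousAt.continuousWithinAt ?_
    unfold upperMean
    refine ContinuousAt.mul (by fun_prop) (ContinuousAt.log ?_ h2)
    refine continuousAt_const.add (continuousAt_const.mul (ContinuousAt.div ?_ ?_ h1)) <;>
      fun_prop

lemma continuousOn_R2max : ContinuousOn (fun x : ℝ × ℝ => S.R2max x.1 x.2) S.Omega := by
  refine ContinuousOn.add (continuousOn_snd.mul (ContinuousOn.log (continuousOn_const.add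
    (continuousOn_const.mul (continuousOn_fst.sub
      (continuousOn_const.div continuousOn_snd ?_)))) ?_)) (continuousOn_upper_rate hP)
  · rintro ⟨ω, F⟩ hx
    exact (Omega.F_pos hP hx).ne'
  · rintro ⟨ω, F⟩ hx
    exact (one_add_mul_pos S.v_pos (Omega.mean_nonneg hP hx)).ne'

lemma continuousOn_Q1 : ContinuousOn (fun x : ℝ × ℝ => S.Q1 x.1 x.2) S.Omega :=
  (continuousOn_R1min hP).sub (continuousOn_R2max hP)

lemma continuousOn_Q2 : ContinuousOn (fun x : ℝ × ℝ => S.Q2 x.1 x.2) S.Omega := by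
  have hne : ∀ x ∈ S.Omega, x.1 ≠ 0 := fun x hx => (Omega.pos hP hx).ne'
  have hdiv : ContinuousOn (fun x : ℝ × ℝ => S.Pnorm / x.1) S.Omega :=
    continuousOn_const.div continuousOn_fst hne
  refine ContinuousOn.sub (ContinuousOn.add ((continuousOn_snd.sub hdiv).mul
    (ContinuousOn.log (by fun_prop) ?_)) (continuousOn_upper_rate hP))
    (hdiv.mul (ContinuousOn.log (by fun_prop) ?_))
  · rintro ⟨ω, F⟩ hx
    exact (one_add_mul_pos S.v_pos (Omega.pos hP hx).le).ne'
  · rintro ⟨ω, F⟩ hx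
    exact (one_add_mul_pos S.β₀_pos (Omega.pos hP hx).le).ne'

lemma isCompact_curve : IsCompact S.curve := by
  have hcl : IsClosed (S.Omega ∩ (fun x : ℝ × ℝ => S.Q1 x.1 x.2) ⁻¹' {0}) :=
    (continuousOn_Q1 hP).preimage_isClosed_of_isClosed (isCompact_Omega hP).isClosed
      isClosed_singleton
  exact (isCompact_Omega hP).of_isClosed_subset hcl fun x hx => hx.1

lemma continuousOn_lower : ContinuousOn (fun ω => (ω, S.Pnorm / ω))
    (Icc S.V1.1 (S.Pnorm + S.pavg)) :=
  continuousOn_id.prodMk (continuousOn_const.div continuousOn_id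
    fun _ hω => ((V1_fst_pos hP).trans_le hω.1).ne')

lemma continuousOn_upper : ContinuousOn
    (fun ω => (ω, (S.pmax - S.pavg - S.Pnorm) / (S.pmax - ω)))
    (Icc S.V1.1 (S.Pnorm + S.pavg)) := by
  refine continuousOn_id.prodMk (continuousOn_const.div (by fun_prop) fun ω hω => ?_)
  have := hω.2
  unfold P0 at hP
  exact (show 0 < S.pmax - ω by linarith).ne'

/-! ### Pushing points of `Ω` to the curve `Q1 = 0`. -/

/-- A point where the second hop is the bottleneck even at its best is dominated by a point of
the curve `Q₁ = 0`. -/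
lemma exists_curve_R2max_le (h2 : S.Q1 S.V2.1 S.V2.2 ≤ 0) {ω F : ℝ} (hx : (ω, F) ∈ S.Omega)
    (hQ : 0 ≤ S.Q1 ω F) : ∃ y ∈ S.curve, S.R2max ω F ≤ S.R1min y.1 y.2 := by
  have hW := Omega.le_W hP hx
  have hF1 := Omega.F_le_one hP hx
  have hxW := Omega.move_right hP hx hW le_rfl
  -- `R2max` grows to the right, so go right until `Q1` vanishes. If the edge `ω = 𝒫 + p̄` comes
  -- first, continue up it towards `V2`, where `Q1 ≤ 0`.
  rcases le_total (S.Q1 (S.Pnorm + S.pavg) F) 0 with h | h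
  · have hm : MapsTo (fun t : ℝ => (t, F)) (Icc ω (S.Pnorm + S.pavg)) S.Omega :=
      fun t ht => Omega.move_right hP hx ht.1 ht.2
    have hc := (continuousOn_Q1 hP).comp (f := fun t : ℝ => (t, F)) (by fun_prop) hm
    obtain ⟨t, ht, h0⟩ := intermediate_value_Icc' hW hc ⟨h, hQ⟩
    simp only [Function.comp_apply] at h0
    refine ⟨(t, F), ⟨hm ht, h0⟩, ?_⟩
    have := R2max_monotone_left hP hx (hm ht) ht.1
    unfold Q1 at h0
    simp only
    linarith
  · have hm : MapsTo (fun t : ℝ => (S.Pnorm + S.pavg, t)) (Icc F 1) S.Omega := fun t ht =>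
      right_mem hP ((Omega.move_right hP hx hW le_rfl).2.2.1.trans ht.1) ht.2
    have hc := (continuousOn_Q1 hP).comp (f := fun t : ℝ => (S.Pnorm + S.pavg, t))
      (by fun_prop) hm
    obtain ⟨t, ht, h0⟩ := intermediate_value_Icc' hF1 hc ⟨h2, h⟩
    simp only [Function.comp_apply] at h0
    refine ⟨(S.Pnorm + S.pavg, t), ⟨hm ht, h0⟩, ?_⟩
    have h3 := R2max_monotone_left hP hx hxW hW
    have hxt := hm ht
    -- On this edge the upper mass sits exactly at `𝒫 + p̄`, so raising `F` merges part of it with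
    -- the lower point mass and increases `R2max`.
    have hup : ∀ G, (S.Pnorm + S.pavg, G) ∈ S.Omega →
        (1 - G) * Real.log (1 + S.v * S.upperMean (S.Pnorm + S.pavg) G) =
        (1 - G) * Real.log (1 + S.v * (S.Pnorm + S.pavg)) := by
      intro G hG
      rcases eq_or_ne G 1 with h | h
      · simp [h]
      · have h1 : (1 : ℝ) - G ≠ 0 := sub_ne_zero.2 h.symm
        have : S.upperMean (S.Pnorm + S.pavg) G = S.Pnorm + S.pavg := by
          rw [upperMean]; field_simp
        rw [this]
    have h4 := merge_log (k := S.v) (s := F) (t := t - F) (u := t)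
      (x := S.Pnorm + S.pavg - S.Pnorm / F) (y := S.Pnorm + S.pavg)
      (z := S.Pnorm + S.pavg - S.Pnorm / t) S.v_pos (Omega.F_pos hP hx).le (sub_nonneg.2 ht.1)
      (Omega.mean_nonneg hP hxW) (Omega.pos hP hxW).le (by ring)
      (by rw [Omega.F_mul_mean hP hxW, Omega.F_mul_mean hP hxt]; ring)
    have h5 : S.R2max (S.Pnorm + S.pavg) F ≤ S.R2max (S.Pnorm + S.pavg) t := by
      rw [R2max, R2max, hup F hxW, hup t hxt]
      linarith
    unfold Q1 at h0
    simp only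
    linarith

/-- A point where the first hop is the bottleneck when the second is at its best is dominated by a
point of the curve `Q₁ = 0`. -/
lemma exists_curve_R1min_le (h1 : 0 ≤ S.Q1 S.V1.1 S.V1.2) {ω F : ℝ} (hx : (ω, F) ∈ S.Omega)
    (hQ : S.Q1 ω F ≤ 0) : ∃ y ∈ S.curve, S.R1min ω F ≤ S.R1min y.1 y.2 := by
  have hW := Omega.le_W hP hx
  have hV := Omega.V1_le hP hx
  have hF := hx.2.2.1
  simp only at hF
  have hxl := lower_mem hP hV hW
  -- `R1min` grows downwards, so lower `F` until `Q1` vanishes. If the lower boundary comes first,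
  -- follow it left towards `V1`: there `R1min = R1max`, which grows as `ω` falls, and `Q1` is
  -- nonnegative at `V1`.
  rcases le_total 0 (S.Q1 ω (S.Pnorm / ω)) with h | h
  · have hm : MapsTo (fun t : ℝ => (ω, t)) (Icc (S.Pnorm / ω) F) S.Omega :=
      fun t ht => Omega.move_down hP hx ht.2 ht.1
    have hc := (continuousOn_Q1 hP).comp (f := fun t : ℝ => (ω, t)) (by fun_prop) hm
    obtain ⟨t, ht, h0⟩ := intermediate_value_Icc' hF hc ⟨hQ, h⟩
    exact ⟨(ω, t), ⟨hm ht, h0⟩, R1min_antitone_right hP (hm ht) hx ht.2⟩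
  · have hsub : Icc S.V1.1 ω ⊆ Icc S.V1.1 (S.Pnorm + S.pavg) := Icc_subset_Icc_right hW
    have hm : MapsTo (fun t : ℝ => (t, S.Pnorm / t)) (Icc S.V1.1 ω) S.Omega :=
      fun t ht => lower_mem hP (hsub ht).1 (hsub ht).2
    have hc := (continuousOn_Q1 hP).comp ((continuousOn_lower hP).mono hsub) hm
    rw [V1_snd hP] at h1
    obtain ⟨t, ht, h0⟩ := intermediate_value_Icc' hV hc ⟨h, h1⟩
    refine ⟨(t, S.Pnorm / t), ⟨hm ht, h0⟩, ?_⟩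
    have h3 := R1min_le_R1max hP hx
    simp only
    rw [R1min_lower hP (hsub ht).1 (hsub ht).2]
    refine h3.trans ?_
    have ht0 := (V1_fst_pos hP).trans_le ht.1
    have h5 := mul_le_mul_of_nonneg_left (chord_log S.β₀_pos ht0.le ht.2) S.Pnorm_pos.le
    rw [R1max, R1max, div_mul_eq_mul_div, div_mul_eq_mul_div,
      div_le_div_iff₀ (Omega.pos hP hx) ht0]
    linarith

lemma exists_curve_min_le (h1 : 0 ≤ S.Q1 S.V1.1 S.V1.2) (h2 : S.Q1 S.V2.1 S.V2.2 ≤ 0) {ω F : ℝ}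
    (hx : (ω, F) ∈ S.Omega) :
    ∃ y ∈ S.curve, min (S.R1min ω F) (S.R2max ω F) ≤ S.R1min y.1 y.2 := by
  rcases le_total 0 (S.Q1 ω F) with h | h
  · obtain ⟨y, hy, h⟩ := exists_curve_R2max_le hP h2 hx h
    exact ⟨y, hy, (min_le_right _ _).trans h⟩
  · obtain ⟨y, hy, h⟩ := exists_curve_R1min_le hP h1 hx h
    exact ⟨y, hy, (min_le_left _ _).trans h⟩

/-! ### The subregions -/

lemma Omega2_eq_iff : S.Omega2 = S.Omega ↔ S.Pnorm ≤ S.P3 := by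
  rw [le_P3_iff hP]
  constructor
  · intro h
    have : (S.V1.1, S.V1.2) ∈ S.Omega2 := h ▸ V1_mem hP
    exact sub_nonneg.2 this.2
  · intro h
    refine Subset.antisymm (fun x hx => hx.1) fun x hx => ⟨hx, ?_⟩
    exact sub_nonneg.1 (h.trans (Q2_V1_le hP hx))

/-- The condition at `V3` is implied by the one at `V2`, where `Q1` is least. -/
lemma max_le_iff_Q1_V2 : max S.P2 S.P4 ≤ S.Pnorm ↔ 0 ≤ S.Q1 S.V2.1 S.V2.2 := by
  rw [max_le_iff, P2_le_iff hP, P4_le_iff hP]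
  exact ⟨fun h => h.1, fun h => ⟨h, h.trans (Q1_V2_le hP (V3_mem hP))⟩⟩

lemma Omega1_eq_iff : S.Omega1 = S.Omega ↔ max S.P2 S.P4 ≤ S.Pnorm := by
  rw [max_le_iff_Q1_V2 hP]
  constructor
  · intro h
    have : (S.V2.1, S.V2.2) ∈ S.Omega1 := h ▸ V2_mem hP
    exact sub_nonneg.2 this.2
  · intro h
    refine Subset.antisymm (fun x hx => hx.1) fun x hx => ⟨hx, ?_⟩
    exact sub_nonneg.1 (h.trans (Q1_V2_le hP hx))

lemma P3_le_iff : S.P3 ≤ S.Pnorm ↔ 0 ≤ S.Q1 S.V1.1 S.V1.2 := by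
  have hM := S.pmax_pos
  have hp := S.pavg_pos
  have hb := S.β₀_pos
  have hd := sub_pos.2 (pavg_lt_pmax hP)
  have hv := one_add_mul_pos S.v_pos hM.le
  have hω := one_add_mul_pos hb (V1_fst_pos hP).le
  have h1 : 0 ≤ S.Q1 S.V1.1 S.V1.2 ↔
      Real.log ((1 + S.pmax * S.v) ^ (S.pavg / (S.pmax - S.pavg))) ≤
      Real.log (1 + S.β₀ * S.V1.1) := by
    rw [mul_comm S.pmax, Real.log_rpow hv, Q1_V1 hP, neg_nonneg, Q2_V1 hP, sub_nonpos,
      one_sub_div hM.ne',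
      div_mul_eq_mul_div, div_mul_eq_mul_div, div_le_div_iff_of_pos_right hM,
      div_mul_eq_mul_div, div_le_iff₀ hd, mul_comm (S.pmax - S.pavg)]
  rw [h1, Real.log_le_log_iff (Real.rpow_pos_of_pos (by rwa [mul_comm]) _) hω, P3]
  set X := (1 + S.pmax * S.v) ^ (S.pavg / (S.pmax - S.pavg))
  rw [div_mul_eq_mul_div, div_le_iff₀ (mul_pos hM hb)]
  change _ ↔ X ≤ 1 + S.β₀ * (S.pmax * S.Pnorm / (S.pmax - S.pavg))
  rw [← sub_le_iff_le_add', ← mul_div_assoc, le_div_iff₀ hd]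
  constructor <;> intro h <;> linarith

lemma Omega1_nonempty_iff : S.Omega1.Nonempty ↔ S.P3 ≤ S.Pnorm := by
  rw [P3_le_iff hP]
  constructor
  · rintro ⟨x, hx, h⟩
    exact (sub_nonneg.2 h).trans (Q1_le_V1 hP hx)
  · intro h
    exact ⟨(S.V1.1, S.V1.2), V1_mem hP, sub_nonneg.1 h⟩

lemma Omega2_nonempty_iff : S.Omega2.Nonempty ↔ S.Pnorm ≤ S.P4 := by
  rw [le_P4_iff hP]
  constructor
  · rintro ⟨x, hx, h⟩
    exact (sub_nonneg.2 h).trans (Q2_le_V3 hP hx)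
  · intro h
    exact ⟨(S.V3.1, S.V3.2), V3_mem hP, sub_nonneg.1 h⟩

/-- If `V2` itself fails, `Q1 - Q2` changes sign along the upper boundary from `V1` to `V2`. At a
zero away from `V1` the inner mean is positive, so `R1min < R1max` strictly and `Q1 + Q2 < 0`; as
`Q1 = Q2`, both are negative. -/
lemma Omega3_nonempty_of (h3 : 0 < S.Q1 S.V1.1 S.V1.2) (h2 : S.Q1 S.V2.1 S.V2.2 < 0) :
    S.Omega3.Nonempty := by
  rcases lt_or_ge (S.Q2 S.V2.1 S.V2.2) 0 with h | h
  · exact ⟨_, (mem_Omega3_iff (V2_mem hP)).2 ⟨h2, h⟩⟩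
  set U : ℝ → ℝ × ℝ := fun ω => (ω, (S.pmax - S.pavg - S.Pnorm) / (S.pmax - ω)) with hU
  have hW := (V1_fst_lt hP).le
  have hm : MapsTo U (Icc S.V1.1 (S.Pnorm + S.pavg)) S.Omega :=
    fun t ht => upper_mem hP ht.1 ht.2
  have hc := ((continuousOn_Q1 hP).sub (continuousOn_Q2 hP)).comp (continuousOn_upper hP) hm
  have hV1 : U S.V1.1 = (S.V1.1, S.V1.2) := by
    have h1 := V1_fst_mul hP
    have h4 := pavg_lt_pmax hP
    have h5 : 0 < S.pmax - S.V1.1 := sub_pos.2 (Omega.lt_pmax hP (V1_mem hP))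
    have h6 := S.pmax_pos
    refine Prod.ext rfl ?_
    change _ / (S.pmax - S.V1.1) = 1 - S.pavg / S.pmax
    rw [div_eq_iff h5.ne']
    field_simp
    linarith
  have hV2 : U (S.Pnorm + S.pavg) = (S.V2.1, S.V2.2) := by
    have h5 : 0 < S.pmax - (S.Pnorm + S.pavg) := sub_pos.2 (Omega.lt_pmax hP (V2_mem hP))
    refine Prod.ext rfl ?_
    change _ / (S.pmax - (S.Pnorm + S.pavg)) = 1
    rw [div_eq_one_iff_eq h5.ne']
    ring
  have e1 := Q1_V1 hP
  have h00 : (0 : ℝ) ∈ Icc (S.Q1 (U (S.Pnorm + S.pavg)).1 (U (S.Pnorm + S.pavg)).2 -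
      S.Q2 (U (S.Pnorm + S.pavg)).1 (U (S.Pnorm + S.pavg)).2)
      (S.Q1 (U S.V1.1).1 (U S.V1.1).2 - S.Q2 (U S.V1.1).1 (U S.V1.1).2) := by
    rw [hV1, hV2]
    exact ⟨by simp only; linarith, by simp only; linarith⟩
  obtain ⟨t, ht, h0⟩ := intermediate_value_Icc' hW hc h00
  have h0' : S.Q1 (U t).1 (U t).2 = S.Q2 (U t).1 (U t).2 := sub_eq_zero.1 h0
  have hx := hm ht
  -- At `V1` one has `Q1 = -Q2`, so `Q1 = Q2` would force `Q1 = 0` there.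
  have ht1 : t ≠ S.V1.1 := by
    rintro rfl
    rw [hV1] at h0'
    simp only at h0'
    linarith
  have ht2 : S.V1.1 < t := lt_of_le_of_ne ht.1 ht1.symm
  have ha : 0 < (U t).1 - S.Pnorm / (U t).2 := by
    have hF := Omega.F_pos hP hx
    have h1 := V1_fst_mul hP
    have h4 := pavg_lt_pmax hP
    have h5 : 0 < S.pmax - t := sub_pos.2 (Omega.lt_pmax hP hx)
    rw [sub_pos, div_lt_iff₀ hF]
    change S.Pnorm < t * (_ / (S.pmax - t))
    rw [← mul_div_assoc, lt_div_iff₀ h5]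
    nlinarith
  have hlt := R1min_lt_R1max hP hx ha
  have hle := R2min_le_R2max hP hx
  refine ⟨_, (mem_Omega3_iff hx).2 ?_⟩
  unfold Q1 Q2 at *
  constructor <;> linarith

lemma Omega3_nonempty_iff :
    S.Omega3.Nonempty ↔ S.P3 < S.Pnorm ∧ S.Pnorm < max S.P2 S.P4 := by
  rw [← not_le, ← not_le, ← Omega2_eq_iff hP, ← Omega1_eq_iff hP]
  constructor
  · rintro ⟨x, hx, hx'⟩
    exact ⟨fun h => hx' (Or.inr (h ▸ hx)), fun h => hx' (Or.inl (h ▸ hx))⟩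
  · rintro ⟨h1, h2⟩
    rw [Omega2_eq_iff hP, le_P3_iff hP, not_le] at h1
    rw [Omega1_eq_iff hP, max_le_iff_Q1_V2 hP, not_le] at h2
    exact Omega3_nonempty_of hP (by rw [Q1_V1 hP]; linarith) h2

end Continuity

/-! ### Distributions with bounded support -/

lemma ae_mem_of_compl {g : Measure ℝ} {s : Set ℝ} (h : g sᶜ = 0) : ∀ᵐ p ∂g, p ∈ s :=
  mem_ae_iff.2 h

lemma integrable_of_compl {g : Measure ℝ} [IsFiniteMeasure g] {c : ℝ} (h : g (Icc 0 c)ᶜ = 0)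
    {φ : ℝ → ℝ} (hφ : ContinuousOn φ (Icc 0 c)) : Integrable φ g := by
  have h1 : IntegrableOn φ (Icc 0 c) g := hφ.integrableOn_compact isCompact_Icc
  rwa [IntegrableOn, Measure.restrict_eq_self_of_ae_mem (ae_mem_of_compl h)] at h1

lemma continuousOn_log_one_add_mul {k : ℝ} (hk : 0 < k) (c : ℝ) :
    ContinuousOn (fun p : ℝ => Real.log (1 + k * p)) (Icc 0 c) :=
  ContinuousOn.log (by fun_prop) fun _ hp => (one_add_mul_pos hk hp.1).ne'

/-- The mixture of two distributions with weights `t` and `1 - t`. -/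
noncomputable def mix (t : ℝ) (g g' : Measure ℝ) : Measure ℝ :=
  ENNReal.ofReal t • g + ENNReal.ofReal (1 - t) • g'

section Mix

variable {t : ℝ} {g g' : Measure ℝ} (h0 : 0 ≤ t) (h1 : t ≤ 1)
include h0 h1

lemma isProbabilityMeasure_mix [IsProbabilityMeasure g] [IsProbabilityMeasure g'] :
    IsProbabilityMeasure (mix t g g') := by
  constructor
  simp only [mix, Measure.add_apply, Measure.smul_apply, measure_univ, smul_eq_mul, mul_one]
  rw [← ENNReal.ofReal_add h0 (sub_nonneg.2 h1)]
  simp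

lemma integral_mix {φ : ℝ → ℝ} (hg : Integrable φ g) (hg' : Integrable φ g') :
    ∫ p, φ p ∂(mix t g g') = t * ∫ p, φ p ∂g + (1 - t) * ∫ p, φ p ∂g' := by
  rw [mix, integral_add_measure (hg.smul_measure ENNReal.ofReal_ne_top)
    (hg'.smul_measure ENNReal.ofReal_ne_top), integral_smul_measure, integral_smul_measure,
    ENNReal.toReal_ofReal h0, ENNReal.toReal_ofReal (sub_nonneg.2 h1)]
  rfl

end Mix

lemma mix_compl {t : ℝ} {g g' : Measure ℝ} {s : Set ℝ} (hg : g sᶜ = 0) (hg' : g' sᶜ = 0) :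
    mix t g g' sᶜ = 0 := by
  simp [mix, hg, hg']

lemma dirac_compl {x : ℝ} {s : Set ℝ} (hs : MeasurableSet s) (h : x ∈ s) :
    Measure.dirac x sᶜ = 0 := by
  simp [Measure.dirac_apply' _ hs.compl, h]

lemma integrable_dirac_real (φ : ℝ → ℝ) (x : ℝ) : Integrable φ (Measure.dirac x) :=
  integrable_dirac (by simp)

/-! ### Reduction of the allocation problem -/

lemma log_one_add_div {k ω p : ℝ} (hk : 0 < k) (hp : 0 ≤ p) (hpω : p ≤ ω) :
    Real.log (1 + k * max (ω - p) 0 / (1 + k * p)) =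
      Real.log (1 + k * ω) - Real.log (1 + k * p) := by
  have h1 := one_add_mul_pos hk hp
  have h2 := one_add_mul_pos hk (hp.trans hpω)
  rw [max_eq_left (sub_nonneg.2 hpω), ← Real.log_div h2.ne' h1.ne']
  congr 1
  field_simp
  ring

lemma continuousOn_R1_integrand (S : RelaySystem) (ω : ℝ) : ContinuousOn
    (fun p => Real.log (1 + S.β₀ * max (ω - p) 0 / (1 + S.β₀ * p))) (Icc 0 S.pmax) := by
  have hb := S.β₀_pos
  refine ContinuousOn.log (continuousOn_const.add (ContinuousOn.div (by fun_prop) (by fun_prop)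
    fun p hp => (one_add_mul_pos hb hp.1).ne')) fun p hp => ?_
  have h1 := one_add_mul_pos hb hp.1
  have : 0 ≤ S.β₀ * max (ω - p) 0 / (1 + S.β₀ * p) :=
    div_nonneg (mul_nonneg hb.le (le_max_right _ _)) h1.le
  exact (show (0 : ℝ) < 1 + _ by linarith).ne'

/-- Splitting the average of a function at the water level. -/
lemma integral_split {f : Measure ℝ} [IsFiniteMeasure f] {M ω : ℝ} (hf : f (Icc 0 M)ᶜ = 0)
    {φ ψ χ : ℝ → ℝ} (hφ : ContinuousOn φ (Icc 0 M))
    (h1 : ∀ p, 0 ≤ p → p ≤ ω → φ p = ψ p) (h2 : ∀ p, 0 ≤ p → p ≤ M → ω < p → φ p = χ p) :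
    ∫ p, φ p ∂f = ∫ p in Icc 0 ω, ψ p ∂f + ∫ p in (Icc 0 ω)ᶜ, χ p ∂f := by
  rw [← integral_add_compl (measurableSet_Icc (a := (0 : ℝ)) (b := ω)) (integrable_of_compl hf hφ)]
  congr 1
  · exact setIntegral_congr_fun measurableSet_Icc fun p hp => h1 p hp.1 hp.2
  · refine setIntegral_congr_ae measurableSet_Icc.compl ?_
    filter_upwards [ae_mem_of_compl hf] with p hp hp'
    refine h2 p hp.1 hp.2 ?_
    by_contra! hc
    exact hp' ⟨hp.1, hc⟩

lemma integral_affine {g : Measure ℝ} [IsProbabilityMeasure g] (hi : Integrable (fun p : ℝ => p) g)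
    (A B : ℝ) : ∫ p, (A + B * p) ∂g = A + B * ∫ p, p ∂g := by
  rw [integral_add (integrable_const _) (hi.const_mul _), integral_const_mul]
  simp

section Reduction

variable (hP : S.Pnorm < S.P0) {f : Measure ℝ} {ω : ℝ} (hf : S.IsFeasible f ω)
include hf

lemma IsFeasible.lower_mean : f.real (Icc 0 ω) * ω - ∫ p in Icc 0 ω, p ∂f = S.Pnorm := by
  obtain ⟨hprob, hsupp, -, hs⟩ := hf
  have h := integral_split (ω := ω) (φ := fun p => max (ω - p) 0) (ψ := fun p => ω - p)
    (χ := fun _ => 0) hsupp (by fun_prop) (fun p _ hp => max_eq_left (sub_nonneg.2 hp))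
    (fun p _ _ hp => max_eq_right (sub_nonpos.2 hp.le))
  have hi : Integrable (fun p : ℝ => p) f := integrable_of_compl hsupp continuousOn_id
  rw [hs, integral_zero, add_zero, integral_sub (integrable_const _) hi.integrableOn,
    setIntegral_const, smul_eq_mul] at h
  exact h.symm

lemma IsFeasible.add_mean :
    ∫ p in Icc 0 ω, p ∂f + ∫ p in (Icc 0 ω)ᶜ, p ∂f = S.pavg := by
  obtain ⟨hprob, hsupp, hm, -⟩ := hf
  rw [← hm]
  exact integral_add_compl measurableSet_Icc (integrable_of_compl hsupp continuousOn_id)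

lemma IsFeasible.real_compl : f.real (Icc 0 ω)ᶜ = 1 - f.real (Icc 0 ω) := by
  have := hf.1
  exact probReal_compl_eq_one_sub measurableSet_Icc

lemma IsFeasible.upper_ge :
    (1 - f.real (Icc 0 ω)) * ω ≤ ∫ p in (Icc 0 ω)ᶜ, p ∂f := by
  have hr := hf.real_compl
  obtain ⟨hprob, hsupp, -, -⟩ := hf
  have hi : Integrable (fun p : ℝ => p) f := integrable_of_compl hsupp continuousOn_id
  rw [← hr, ← smul_eq_mul, ← setIntegral_const]
  refine setIntegral_mono_on_ae (integrable_const _).integrableOn hi.integrableOn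
    measurableSet_Icc.compl ?_
  filter_upwards [ae_mem_of_compl hsupp] with p hp hp'
  by_contra! hc
  exact hp' ⟨hp.1, hc.le⟩

lemma IsFeasible.upper_le :
    ∫ p in (Icc 0 ω)ᶜ, p ∂f ≤ (1 - f.real (Icc 0 ω)) * S.pmax := by
  have hr := hf.real_compl
  obtain ⟨hprob, hsupp, -, -⟩ := hf
  have hi : Integrable (fun p : ℝ => p) f := integrable_of_compl hsupp continuousOn_id
  rw [← hr, ← smul_eq_mul, ← setIntegral_const]
  refine setIntegral_mono_on_ae hi.integrableOn (integrable_const _).integrableOn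
    measurableSet_Icc.compl ?_
  filter_upwards [ae_mem_of_compl hsupp] with p hp _
  exact hp.2

include hP

lemma IsFeasible.mem_Omega : (ω, f.real (Icc 0 ω)) ∈ S.Omega := by
  have h1 := hf.lower_mean
  have h2 := hf.add_mean
  have h3 : 0 ≤ ∫ p in Icc 0 ω, p ∂f := setIntegral_nonneg measurableSet_Icc fun _ hp => hp.1
  have h4 := hf.upper_ge
  have h5 := hf.upper_le
  have hpr := hf.1
  have h6 : f.real (Icc 0 ω) ≤ 1 := measureReal_le_one
  have h7 : 0 ≤ f.real (Icc 0 ω) := measureReal_nonneg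
  set F := f.real (Icc 0 ω)
  have hPp := S.Pnorm_pos
  have hFω : 0 < F * ω := by linarith
  have hω : 0 < ω := pos_of_mul_pos_right hFω h7
  have hW : ω ≤ S.Pnorm + S.pavg := by linarith
  have hup : F * (S.pmax - ω) ≤ S.pmax - S.pavg - S.Pnorm := by linarith
  refine (mem_Omega_iff hP).2 ⟨?_, hW, by linarith, hup⟩
  have hd := sub_pos.2 (pavg_lt_pmax hP)
  refine (div_le_iff₀ hd).2 ?_
  have h8 : 0 < S.pmax - ω := by unfold P0 at hP; linarith
  -- Eliminating `F` between its two bounds gives `𝒫 (pmax - ω) ≤ ω (pmax - p̄ - 𝒫)`, which is the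
  -- left bound on `ω`.
  have h9 := mul_le_mul_of_nonneg_right (show S.Pnorm ≤ F * ω by linarith) h8.le
  have h10 := mul_le_mul_of_nonneg_left hup hω.le
  linarith

lemma IsFeasible.exists_inner : ∃ g, S.IsInner ω (f.real (Icc 0 ω)) g ∧
    S.R1 f ω = S.innerR1 ω (f.real (Icc 0 ω)) g ∧
    S.R2 f ≤ S.innerR2 ω (f.real (Icc 0 ω)) g := by
  have hx := hf.mem_Omega hP
  have h1 := hf.lower_mean
  have h2 := hf.add_mean
  have hr := hf.real_compl
  obtain ⟨hprob, hsupp, -, -⟩ := hf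
  have hF := Omega.F_pos hP hx
  have hm := Omega.mul_upperMean hP hx
  have hm0 := Omega.upperMean_nonneg hP hx
  set F := f.real (Icc 0 ω) with hFdef
  have hne : f (Icc 0 ω) ≠ 0 := fun h => by simp [hFdef, Measure.real, h] at hF
  set g := (f (Icc 0 ω))⁻¹ • f.restrict (Icc 0 ω) with hg
  have hint : ∀ φ : ℝ → ℝ, F * ∫ p, φ p ∂g = ∫ p in Icc 0 ω, φ p ∂f := by
    intro φ
    rw [hg, integral_smul_measure, ENNReal.toReal_inv, smul_eq_mul]
    exact mul_inv_cancel_left₀ hF.ne' _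
  refine ⟨g, ⟨⟨?_⟩, ?_, ?_⟩, ?_, ?_⟩
  · simp only [hg, Measure.smul_apply, Measure.restrict_apply_univ, smul_eq_mul]
    exact ENNReal.inv_mul_cancel hne (measure_ne_top _ _)
  · simp [hg, Measure.restrict_apply measurableSet_Icc.compl]
  · have := hint fun p => p
    refine mul_left_cancel₀ hF.ne' ?_
    rw [this, Omega.F_mul_mean hP hx]
    linarith
  · have h := integral_split (ω := ω) hsupp (continuousOn_R1_integrand S ω)
      (ψ := fun p => Real.log (1 + S.β₀ * ω) - Real.log (1 + S.β₀ * p)) (χ := fun _ => 0)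
      (fun p hp hpω => log_one_add_div S.β₀_pos hp hpω)
      (fun p hp _ hpω => by simp [max_eq_right (sub_nonpos.2 hpω.le)])
    rw [R1, h, integral_zero, add_zero, innerR1, hint, integral_sub (integrable_const _)
      ((continuousOn_log_one_add_mul S.β₀_pos ω).integrableOn_compact isCompact_Icc),
      setIntegral_const, smul_eq_mul]
  · have hlog := integrable_of_compl hsupp (continuousOn_log_one_add_mul S.v_pos S.pmax)
    have hi : Integrable (fun p : ℝ => p) f := integrable_of_compl hsupp continuousOn_id
    rw [R2, innerR2, hint, ← integral_add_compl (measurableSet_Icc (a := (0 : ℝ)) (b := ω)) hlog]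
    refine add_le_add_right ?_ _
    set m := S.upperMean ω F
    -- Jensen through the tangent at `m`, without normalizing the upper part, so the case of zero
    -- upper mass needs no separate treatment.
    set c := S.v / (1 + S.v * m)
    calc ∫ p in (Icc 0 ω)ᶜ, Real.log (1 + S.v * p) ∂f
        ≤ ∫ p in (Icc 0 ω)ᶜ, ((Real.log (1 + S.v * m) - c * m) + c * p) ∂f := by
          refine setIntegral_mono_on_ae hlog.integrableOn
            ((integrable_const _).add (hi.const_mul c)).integrableOn measurableSet_Icc.compl ?_
          filter_upwards [ae_mem_of_compl hsupp] with p hp _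
          have := log_le_tangent S.v_pos hm0 hp.1
          linarith
      _ = (1 - F) * (Real.log (1 + S.v * m) - c * m) + c * ∫ p in (Icc 0 ω)ᶜ, p ∂f := by
          rw [integral_add (integrable_const _) (hi.const_mul c).integrableOn,
            setIntegral_const, smul_eq_mul, integral_const_mul, hr]
      _ = (1 - F) * Real.log (1 + S.v * m) := by
          have : ∫ p in (Icc 0 ω)ᶜ, p ∂f = (1 - F) * m := by rw [hm]; linarith
          rw [this]
          ring

end Reduction

/-! ### The inner problem at a fixed point of `Ω`. -/

section Inner

variable (hP : S.Pnorm < S.P0) {ω F : ℝ} (hx : (ω, F) ∈ S.Omega) {g : Measure ℝ}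
include hP hx

lemma glue_spec (hg : S.IsInner ω F g) : S.IsFeasible (S.glue ω F g) ω ∧
    S.R1 (S.glue ω F g) ω = S.innerR1 ω F g ∧ S.R2 (S.glue ω F g) = S.innerR2 ω F g := by
  obtain ⟨hprob, hsupp, hmean⟩ := hg
  have hF := (Omega.F_pos hP hx).le
  have hF1 := Omega.F_le_one hP hx
  have hm := Omega.mul_upperMean hP hx
  have hM := (Omega.lt_pmax hP hx).le
  have hsub : Icc 0 ω ⊆ Icc 0 S.pmax := Icc_subset_Icc_right hM
  have hsupp' : g (Icc 0 S.pmax)ᶜ = 0 := measure_mono_null (compl_subset_compl.2 hsub) hsupp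
  have hi : ∀ φ : ℝ → ℝ, ContinuousOn φ (Icc 0 ω) →
      ∫ p, φ p ∂(S.glue ω F g) = F * ∫ p, φ p ∂g + (1 - F) * φ (S.upperMean ω F) := by
    intro φ hφ
    have := integral_mix (g := g) (g' := Measure.dirac (S.upperMean ω F)) hF hF1
      (integrable_of_compl hsupp hφ) (integrable_dirac_real _ _)
    rwa [integral_dirac] at this
  have hidg : Integrable (fun p : ℝ => p) g := integrable_of_compl hsupp continuousOn_id
  -- The upper atom lies at or above the water level, or has weight zero, so it receives no source
  -- power.
  have hmax : (1 - F) * max (ω - S.upperMean ω F) 0 = 0 := by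
    rcases hF1.lt_or_eq with h | h
    · rw [max_eq_right (sub_nonpos.2 (Omega.le_upperMean hP hx h)), mul_zero]
    · simp [h]
  refine ⟨⟨?_, ?_, ?_, ?_⟩, ?_, ?_⟩
  · exact isProbabilityMeasure_mix hF hF1
  · exact mix_compl hsupp' (dirac_compl measurableSet_Icc
      ⟨Omega.upperMean_nonneg hP hx, Omega.upperMean_le hP hx⟩)
  · rw [hi (fun p => p) continuousOn_id, hmean, hm, Omega.F_mul_mean hP hx]
    ring
  · rw [hi _ (by fun_prop), hmax, add_zero]
    have : ∫ p, max (ω - p) 0 ∂g = ∫ p, (ω - p) ∂g := by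
      refine integral_congr_ae ?_
      filter_upwards [ae_mem_of_compl hsupp] with p hp
      exact max_eq_left (sub_nonneg.2 hp.2)
    rw [this, integral_sub (integrable_const _) hidg, hmean]
    simp only [integral_const, probReal_univ, one_smul, sub_sub_cancel]
    exact mul_div_cancel₀ _ (Omega.F_pos hP hx).ne'
  · rw [R1, hi _ ((continuousOn_R1_integrand S ω).mono hsub)]
    have h2 : (1 - F) * Real.log (1 + S.β₀ * max (ω - S.upperMean ω F) 0 /
        (1 + S.β₀ * S.upperMean ω F)) = 0 := by
      rcases mul_eq_zero.1 hmax with h | h <;> simp [h]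
    have : ∫ p, Real.log (1 + S.β₀ * max (ω - p) 0 / (1 + S.β₀ * p)) ∂g =
        ∫ p, (Real.log (1 + S.β₀ * ω) - Real.log (1 + S.β₀ * p)) ∂g := by
      refine integral_congr_ae ?_
      filter_upwards [ae_mem_of_compl hsupp] with p hp
      exact log_one_add_div S.β₀_pos hp.1 hp.2
    rw [h2, add_zero, this, integral_sub (integrable_const _)
      (integrable_of_compl hsupp (continuousOn_log_one_add_mul S.β₀_pos ω)), innerR1]
    simp only [integral_const, probReal_univ, one_smul]
    ring
  · rw [R2, hi _ (continuousOn_log_one_add_mul S.v_pos ω), innerR2]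

lemma integral_log_le {k : ℝ} (hk : 0 < k) (hg : S.IsInner ω F g) :
    ∫ p, Real.log (1 + k * p) ∂g ≤ Real.log (1 + k * (ω - S.Pnorm / F)) := by
  obtain ⟨hprob, hsupp, hmean⟩ := hg
  have ha := Omega.mean_nonneg hP hx
  set a := ω - S.Pnorm / F
  have hi : Integrable (fun p : ℝ => p) g := integrable_of_compl hsupp continuousOn_id
  calc ∫ p, Real.log (1 + k * p) ∂g
      ≤ ∫ p, ((Real.log (1 + k * a) - k / (1 + k * a) * a) + k / (1 + k * a) * p) ∂g := by
        refine integral_mono_ae (integrable_of_compl hsupp (continuousOn_log_one_add_mul hk ω))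
          ((integrable_const _).add (hi.const_mul _)) ?_
        filter_upwards [ae_mem_of_compl hsupp] with p hp
        have := log_le_tangent hk ha hp.1
        linarith
    _ = _ := by
        rw [integral_affine hi, hmean]
        ring

lemma le_integral_log {k : ℝ} (hk : 0 < k) (hg : S.IsInner ω F g) :
    (F - S.Pnorm / ω) * Real.log (1 + k * ω) ≤ F * ∫ p, Real.log (1 + k * p) ∂g := by
  obtain ⟨hprob, hsupp, hmean⟩ := hg
  have hω := Omega.pos hP hx
  have hi : Integrable (fun p : ℝ => p) g := integrable_of_compl hsupp continuousOn_id
  have h : ∫ p, p * Real.log (1 + k * ω) ∂g ≤ ∫ p, ω * Real.log (1 + k * p) ∂g := by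
    refine integral_mono_ae (hi.mul_const _)
      ((integrable_of_compl hsupp (continuousOn_log_one_add_mul hk ω)).const_mul _) ?_
    filter_upwards [ae_mem_of_compl hsupp] with p hp
    exact chord_log hk hp.1 hp.2
  rw [integral_mul_const, integral_const_mul, hmean] at h
  have h2 := mul_le_mul_of_nonneg_left h (Omega.F_pos hP hx).le
  rw [← mul_assoc, Omega.F_mul_mean hP hx] at h2
  refine le_of_mul_le_mul_left ?_ hω
  have h3 := F_sub_mul hP hx
  calc ω * ((F - S.Pnorm / ω) * Real.log (1 + k * ω))
      = ((F - S.Pnorm / ω) * ω) * Real.log (1 + k * ω) := by ring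
    _ ≤ _ := by rw [h3]; linarith

lemma R1min_le_innerR1 (hg : S.IsInner ω F g) : S.R1min ω F ≤ S.innerR1 ω F g := by
  have := mul_le_mul_of_nonneg_left (integral_log_le hP hx S.β₀_pos hg) (Omega.F_pos hP hx).le
  rw [R1min_eq hP hx, innerR1]
  linarith

lemma innerR1_le_R1max (hg : S.IsInner ω F g) : S.innerR1 ω F g ≤ S.R1max ω := by
  have := le_integral_log hP hx S.β₀_pos hg
  rw [R1max, innerR1]
  linarith

lemma innerR2_le_R2max (hg : S.IsInner ω F g) : S.innerR2 ω F g ≤ S.R2max ω F := by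
  have := mul_le_mul_of_nonneg_left (integral_log_le hP hx S.v_pos hg) (Omega.F_pos hP hx).le
  rw [R2max, innerR2]
  linarith

lemma isInner_dirac : S.IsInner ω F (Measure.dirac (ω - S.Pnorm / F)) :=
  ⟨inferInstance, dirac_compl measurableSet_Icc
    ⟨Omega.mean_nonneg hP hx, (Omega.mean_lt hP hx).le⟩, integral_dirac _ _⟩

lemma innerR1_dirac : S.innerR1 ω F (Measure.dirac (ω - S.Pnorm / F)) = S.R1min ω F := by
  rw [innerR1, integral_dirac, R1min_eq hP hx]
  ring

omit hP hx in
lemma innerR2_dirac : S.innerR2 ω F (Measure.dirac (ω - S.Pnorm / F)) = S.R2max ω F := by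
  rw [innerR2, integral_dirac, R2max]

lemma exists_isInner_extreme : ∃ g, S.IsInner ω F g ∧ S.innerR1 ω F g = S.R1max ω ∧
    S.innerR2 ω F g = S.R2min ω F := by
  have hω := Omega.pos hP hx
  have hF := Omega.F_pos hP hx
  have hFω := mul_pos hF hω
  -- The weight at `0` for which the mixture of `0` and `ω` has mean `ω - 𝒫 / F`.
  set t := S.Pnorm / (F * ω) with ht
  have h0 : 0 ≤ t := div_nonneg S.Pnorm_pos.le hFω.le
  have h1 : t ≤ 1 := (div_le_one hFω).2 (Omega.Pnorm_le hP hx)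
  have hi : ∀ φ : ℝ → ℝ, ∫ p, φ p ∂(mix t (Measure.dirac 0) (Measure.dirac ω)) =
      t * φ 0 + (1 - t) * φ ω := by
    intro φ
    rw [integral_mix h0 h1 (integrable_dirac_real _ _) (integrable_dirac_real _ _),
      integral_dirac, integral_dirac]
  have e : F * (1 - t) = F - S.Pnorm / ω := by
    rw [ht]; field_simp
  refine ⟨mix t (Measure.dirac 0) (Measure.dirac ω), ⟨isProbabilityMeasure_mix h0 h1,
    mix_compl (dirac_compl measurableSet_Icc ⟨le_rfl, hω.le⟩)
      (dirac_compl measurableSet_Icc ⟨hω.le, le_rfl⟩), ?_⟩, ?_, ?_⟩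
  · rw [hi, ht]; field_simp; ring
  · rw [innerR1, hi, R1max]
    simp only [mul_zero, add_zero, Real.log_one, zero_add]
    rw [← mul_assoc, e]; ring
  · rw [innerR2, hi, R2min]
    simp only [mul_zero, add_zero, Real.log_one, zero_add]
    rw [← mul_assoc, e]

omit hP hx in
lemma isInner_mix {g' : Measure ℝ} {t : ℝ} (h0 : 0 ≤ t) (h1 : t ≤ 1) (hg : S.IsInner ω F g)
    (hg' : S.IsInner ω F g') : S.IsInner ω F (mix t g g') ∧
    S.innerR1 ω F (mix t g g') = t * S.innerR1 ω F g + (1 - t) * S.innerR1 ω F g' ∧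
    S.innerR2 ω F (mix t g g') = t * S.innerR2 ω F g + (1 - t) * S.innerR2 ω F g' := by
  obtain ⟨hprob, hsupp, hmean⟩ := hg
  obtain ⟨hprob', hsupp', hmean'⟩ := hg'
  have hi : ∀ φ : ℝ → ℝ, ContinuousOn φ (Icc 0 ω) → ∫ p, φ p ∂(mix t g g') =
      t * ∫ p, φ p ∂g + (1 - t) * ∫ p, φ p ∂g' := fun φ hφ =>
    integral_mix h0 h1 (integrable_of_compl hsupp hφ) (integrable_of_compl hsupp' hφ)
  refine ⟨⟨isProbabilityMeasure_mix h0 h1, mix_compl hsupp hsupp', ?_⟩, ?_, ?_⟩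
  · rw [hi (fun p => p) continuousOn_id, hmean, hmean']; ring
  · rw [innerR1, hi _ (continuousOn_log_one_add_mul S.β₀_pos ω), innerR1, innerR1]; ring
  · rw [innerR2, hi _ (continuousOn_log_one_add_mul S.v_pos ω), innerR2, innerR2]; ring

omit hP hx in
/-- Weights that balance two affine functions. -/
lemma exists_balance {x y x' y' : ℝ} (h : x ≤ y) (h' : y' < x') :
    ∃ t : ℝ, 0 ≤ t ∧ t ≤ 1 ∧ t * x + (1 - t) * x' = t * y + (1 - t) * y' := by
  have hd : 0 < (y - x) + (x' - y') := by linarith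
  refine ⟨(x' - y') / ((y - x) + (x' - y')), div_nonneg (by linarith) hd.le,
    (div_le_one hd).2 (by linarith), ?_⟩
  field_simp
  ring

/-- Mix `g` with the extreme distribution that is best for its weaker hop. Both rates are affine in
the mixing weight and their order is reversed at that extreme, so they meet, and the weaker hop has
only gained. -/
lemma exists_balanced_inner (h1 : S.R1min ω F < S.R2max ω F) (h2 : S.R2min ω F < S.R1max ω)
    (hg : S.IsInner ω F g) : ∃ g', S.IsInner ω F g' ∧
      S.innerR1 ω F g' = S.innerR2 ω F g' ∧
      min (S.innerR1 ω F g) (S.innerR2 ω F g) ≤ S.innerR1 ω F g' := by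
  rcases le_total (S.innerR1 ω F g) (S.innerR2 ω F g) with h | h
  · obtain ⟨g', hg', e1, e2⟩ := exists_isInner_extreme hP hx
    obtain ⟨t, ht0, ht1, ht⟩ := exists_balance h (e1 ▸ e2 ▸ h2)
    obtain ⟨hm, m1, m2⟩ := isInner_mix ht0 ht1 hg hg'
    refine ⟨_, hm, by rw [m1, m2, ht], ?_⟩
    rw [min_eq_left h, m1, e1]
    have := mul_le_mul_of_nonneg_left (innerR1_le_R1max hP hx hg) (sub_nonneg.2 ht1)
    linarith
  · have hg' := isInner_dirac hP hx
    have e1 := innerR1_dirac hP hx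
    have e2 := innerR2_dirac (S := S) (ω := ω) (F := F)
    obtain ⟨t, ht0, ht1, ht⟩ := exists_balance h (e1.symm ▸ e2.symm ▸ h1)
    obtain ⟨hm, m1, m2⟩ := isInner_mix ht0 ht1 hg hg'
    refine ⟨_, hm, by rw [m1, m2, ht], ?_⟩
    rw [min_eq_right h, m1, ← ht, e2]
    have := mul_le_mul_of_nonneg_left (innerR2_le_R2max hP hx hg) (sub_nonneg.2 ht1)
    linarith

/-- If `β₀ ≤ v`, every inner distribution is dominated by a point mass at a smaller `F`. -/
lemma exists_le_min_bounds (hv : S.β₀ ≤ S.v) (hg : S.IsInner ω F g) :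
    ∃ F', (ω, F') ∈ S.Omega ∧
      min (S.innerR1 ω F g) (S.innerR2 ω F g) ≤ min (S.R1min ω F') (S.R2max ω F') := by
  have hω := Omega.pos hP hx
  have hlow : S.Pnorm / ω ≤ F := hx.2.2.1
  have hm : MapsTo (fun t : ℝ => (ω, t)) (Icc (S.Pnorm / ω) F) S.Omega :=
    fun t ht => Omega.move_down hP hx ht.2 ht.1
  have hc := (continuousOn_R1min hP).comp (f := fun t : ℝ => (ω, t)) (by fun_prop) hm
  -- `F'` is chosen so that a point mass there has the first-hop rate of `g`: as `F'` falls to `𝒫 /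
  -- ω`, `R1min` goes from at most that rate up to `R1max`.
  obtain ⟨F', hF', h0⟩ := intermediate_value_Icc' hlow hc
    ⟨R1min_le_innerR1 hP hx hg, (innerR1_le_R1max hP hx hg).trans_eq
      (R1min_lower hP (Omega.V1_le hP hx) (Omega.le_W hP hx)).symm⟩
  simp only [Function.comp_apply] at h0
  have hx' := hm hF'
  refine ⟨F', hx', le_min ((min_le_left _ _).trans_eq h0.symm) ((min_le_right _ _).trans ?_)⟩
  have ha := Omega.mean_nonneg hP hx'
  have hFa := Omega.F_mul_mean hP hx'
  have hF'1 := Omega.F_le_one hP hx'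
  rw [R1min_eq hP hx', innerR1] at h0
  rw [innerR2, R2max]
  obtain ⟨A, B, δ, hdom, e1, e2⟩ :=
    exists_log_dominating S.β₀_pos hv ha (Omega.mean_lt hP hx')
  set a := ω - S.Pnorm / F'
  obtain ⟨hprob, hsupp, hmean⟩ := hg
  have hi : Integrable (fun p : ℝ => p) g := integrable_of_compl hsupp continuousOn_id
  have hib := integrable_of_compl hsupp (continuousOn_log_one_add_mul S.β₀_pos ω)
  have hiv := integrable_of_compl hsupp (continuousOn_log_one_add_mul S.v_pos ω)
  have hiA : Integrable (fun p => A + B * p) g := (integrable_const _).add (hi.const_mul _)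
  have h1 : ∫ p, Real.log (1 + S.v * p) ∂g ≤
      A + B * (ω - S.Pnorm / F) + δ * ∫ p, Real.log (1 + S.β₀ * p) ∂g := by
    calc _ ≤ ∫ p, (A + B * p + δ * Real.log (1 + S.β₀ * p)) ∂g := by
          refine integral_mono_ae hiv
            (hiA.add (hib.const_mul _)) ?_
          filter_upwards [ae_mem_of_compl hsupp] with p hp
          exact hdom p hp.1 hp.2
      _ = _ := by
          rw [integral_add hiA (hib.const_mul _), integral_affine hi, integral_const_mul, hmean]
  have h2 := mul_le_mul_of_nonneg_left h1 (Omega.F_pos hP hx).le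
  have hFm := Omega.F_mul_mean hP hx
  -- `F g` and the measure with mass `F'` at `a` and `F - F'` at `ω` have the same total mass, mean
  -- and integral of `log (1 + β₀ p)` (the last by `h0`). The dominating function thus integrates
  -- equally, and it touches `log (1 + v p)` at both atoms; the sign of `δ` is irrelevant.
  have h3 : F * (A + B * (ω - S.Pnorm / F) + δ * ∫ p, Real.log (1 + S.β₀ * p) ∂g) =
      F' * Real.log (1 + S.v * a) + (F - F') * Real.log (1 + S.v * ω) := by
    rw [← e1, ← e2]
    linear_combination B * hFm - B * hFa + δ * h0
  -- The mass `F - F'` left at `ω` joins the upper atom.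
  have h4 := merge_log (k := S.v) (u := 1 - F') (z := S.upperMean ω F') S.v_pos
    (sub_nonneg.2 hF'.2) (sub_nonneg.2 (Omega.F_le_one hP hx)) hω.le
    (Omega.upperMean_nonneg hP hx) (by ring)
    (by rw [Omega.mul_upperMean hP hx, Omega.mul_upperMean hP hx']; ring)
  linarith

end Inner

/-- The reduced rates form a cofinal subset of all rates, which is enough for the two maxima to
agree. -/
lemma isGreatest_rates_iff (hP : S.Pnorm < S.P0) (R : ℝ) :
    IsGreatest S.rates R ↔ IsGreatest S.omegaRates R := by
  have hsub : S.omegaRates ⊆ S.rates := by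
    rintro r ⟨ω, F, hx, g, hg, rfl⟩
    obtain ⟨h1, h2, h3⟩ := glue_spec hP hx hg
    exact ⟨_, _, h1, by rw [rate, h2, h3]⟩
  have hle : ∀ r ∈ S.rates, ∃ r' ∈ S.omegaRates, r ≤ r' := by
    rintro r ⟨f, ω, hf, rfl⟩
    obtain ⟨g, hg, h1, h2⟩ := hf.exists_inner hP
    exact ⟨_, ⟨_, _, hf.mem_Omega hP, g, hg, rfl⟩, min_le_min h1.le h2⟩
  constructor
  · rintro ⟨hR, hub⟩
    obtain ⟨r', hr', h⟩ := hle R hR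
    have : r' = R := le_antisymm (hub (hsub hr')) h
    exact ⟨this ▸ hr', fun r hr => hub (hsub hr)⟩
  · rintro ⟨hR, hub⟩
    refine ⟨hsub hR, fun r hr => ?_⟩
    obtain ⟨r', hr', h⟩ := hle r hr
    exact h.trans (hub hr')

/-! ### The reduced problem on each subregion -/

section Optimal

variable (hP : S.Pnorm < S.P0)
include hP

lemma isGreatest_innerRates_Omega1 {ω F : ℝ} (h : (ω, F) ∈ S.Omega1) :
    IsGreatest (S.innerRates ω F) (S.R2max ω F) := by
  obtain ⟨hx, hle⟩ := h
  refine ⟨⟨_, isInner_dirac hP hx, ?_⟩, ?_⟩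
  · rw [innerR1_dirac hP hx, innerR2_dirac, min_eq_right hle]
  · rintro r ⟨g, hg, rfl⟩
    exact (min_le_right _ _).trans (innerR2_le_R2max hP hx hg)

lemma isGreatest_innerRates_Omega2 {ω F : ℝ} (h : (ω, F) ∈ S.Omega2) :
    IsGreatest (S.innerRates ω F) (S.R1max ω) := by
  obtain ⟨hx, hle⟩ := h
  obtain ⟨g, hg, e1, e2⟩ := exists_isInner_extreme hP hx
  refine ⟨⟨g, hg, ?_⟩, ?_⟩
  · rw [e1, e2, min_eq_left hle]
  · rintro r ⟨g, hg, rfl⟩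
    exact (min_le_left _ _).trans (innerR1_le_R1max hP hx hg)

/-! ### Optimal allocations -/

omit hP in
lemma twoPoint_eq_glue {ω F : ℝ} :
    twoPoint (1 - F) (S.upperMean ω F) (ω - S.Pnorm / F) =
      S.glue ω F (Measure.dirac (ω - S.Pnorm / F)) := by
  rw [twoPoint, glue, sub_sub_cancel, add_comm]

lemma twoPoint_spec {ω F : ℝ} (hx : (ω, F) ∈ S.Omega) :
    S.IsFeasible (twoPoint (1 - F) (S.upperMean ω F) (ω - S.Pnorm / F)) ω ∧
    S.rate (twoPoint (1 - F) (S.upperMean ω F) (ω - S.Pnorm / F)) ω =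
      min (S.R1min ω F) (S.R2max ω F) := by
  obtain ⟨h1, h2, h3⟩ := glue_spec hP hx (isInner_dirac hP hx)
  rw [twoPoint_eq_glue]
  exact ⟨h1, by rw [rate, h2, h3, innerR1_dirac hP hx, innerR2_dirac]⟩

lemma rate_le_R1max_V1 {f : Measure ℝ} {ω : ℝ} (hf : S.IsFeasible f ω) :
    S.rate f ω ≤ S.R1max S.V1.1 := by
  have hx := hf.mem_Omega hP
  obtain ⟨g, hg, h1, -⟩ := hf.exists_inner hP
  exact (min_le_left _ _).trans (h1.le.trans ((innerR1_le_R1max hP hx hg).trans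
    (R1max_le_V1 hP hx)))

lemma rate_le_log {f : Measure ℝ} {ω : ℝ} (hf : S.IsFeasible f ω) :
    S.rate f ω ≤ Real.log (1 + S.v * S.pavg) := by
  have hx := hf.mem_Omega hP
  obtain ⟨g, hg, -, h2⟩ := hf.exists_inner hP
  exact (min_le_right _ _).trans (h2.trans ((innerR2_le_R2max hP hx hg).trans
    (R2max_le hP hx)))

lemma half_duplex (h : S.Pnorm ≤ S.P3) :
    S.IsOptimal (twoPoint (S.pavg / S.pmax) S.pmax 0) S.V1.1 ∧
    S.rate (twoPoint (S.pavg / S.pmax) S.pmax 0) S.V1.1 = S.R1max S.V1.1 := by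
  have hx := V1_mem hP
  have hsp := twoPoint_spec hP hx
  have e1 : 1 - S.V1.2 = S.pavg / S.pmax := sub_sub_cancel _ _
  have e2 : S.V1.1 - S.Pnorm / S.V1.2 = 0 := by
    rw [V1_snd hP, div_div_cancel₀ S.Pnorm_pos.ne', sub_self]
  rw [e1, e2, upperMean_V1 hP] at hsp
  have hR : S.R1min S.V1.1 S.V1.2 = S.R1max S.V1.1 := by
    rw [V1_snd hP]
    exact R1min_lower hP le_rfl (V1_fst_lt hP).le
  have hQ := (le_P3_iff hP).1 h
  have hle : S.R1min S.V1.1 S.V1.2 ≤ S.R2max S.V1.1 S.V1.2 := by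
    rw [← sub_nonpos]
    change S.Q1 _ _ ≤ 0
    rw [Q1_V1 hP]
    linarith
  rw [min_eq_left hle, hR] at hsp
  exact ⟨⟨hsp.1, fun f ω hf => (rate_le_R1max_V1 hP hf).trans_eq hsp.2.symm⟩, hsp.2⟩

lemma full_duplex (h : max S.P2 S.P4 ≤ S.Pnorm) :
    S.IsOptimal (Measure.dirac S.pavg) (S.Pnorm + S.pavg) ∧
    S.rate (Measure.dirac S.pavg) (S.Pnorm + S.pavg) = Real.log (1 + S.v * S.pavg) := by
  have hsp := twoPoint_spec hP (V2_mem hP)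
  have e : twoPoint (1 - S.V2.2) (S.upperMean S.V2.1 S.V2.2) (S.V2.1 - S.Pnorm / S.V2.2) =
      Measure.dirac S.pavg := by
    simp [twoPoint, V2]
  have hQ := (max_le_iff_Q1_V2 hP).1 h
  rw [e, min_eq_right (sub_nonneg.1 hQ)] at hsp
  have h4 : S.R2max S.V2.1 S.V2.2 = Real.log (1 + S.v * S.pavg) := by
    simp [R2max, V2]
  rw [h4] at hsp
  exact ⟨⟨hsp.1, fun f ω hf => (rate_le_log hP hf).trans_eq hsp.2.symm⟩, hsp.2⟩

section Intermediate

variable (h3 : S.P3 < S.Pnorm) (hmax : S.Pnorm < max S.P2 S.P4)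
include h3 hmax

lemma exists_curve_rate_le (hv : S.β₀ ≤ S.v) {f : Measure ℝ} {ω : ℝ} (hf : S.IsFeasible f ω) :
    ∃ y ∈ S.curve, S.rate f ω ≤ S.R1min y.1 y.2 := by
  have hx := hf.mem_Omega hP
  obtain ⟨g, hg, e1, e2⟩ := hf.exists_inner hP
  obtain ⟨F', hx', hle⟩ := exists_le_min_bounds hP hx hv hg
  obtain ⟨y, hy, hyle⟩ := exists_curve_min_le hP ((P3_le_iff hP).1 h3.le)
    (not_le.1 ((max_le_iff_Q1_V2 hP).not.1 (not_le.2 hmax))).le hx'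
  exact ⟨y, hy, (min_le_min e1.le e2).trans (hle.trans hyle)⟩

lemma exists_max_on_curve :
    ∃ x ∈ S.curve, ∀ y ∈ S.curve, S.R1min y.1 y.2 ≤ S.R1min x.1 x.2 := by
  obtain ⟨y, hy, -⟩ := exists_curve_min_le hP ((P3_le_iff hP).1 h3.le)
    (not_le.1 ((max_le_iff_Q1_V2 hP).not.1 (not_le.2 hmax))).le (V1_mem hP)
  exact (isCompact_curve hP).exists_isMaxOn ⟨y, hy⟩
    ((continuousOn_R1min hP).mono fun x hx => hx.1)

omit h3 in
-- `F = 1` occurs in `Ω` only at `V2`, where `Q1 < 0` in this regime.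
lemma curve_F_lt_one {ω F : ℝ} (hx : (ω, F) ∈ S.curve) : F < 1 := by
  refine (Omega.F_le_one hP hx.1).lt_of_ne ?_
  rintro rfl
  have hω : ω = S.Pnorm + S.pavg := by
    by_contra hne
    exact (Omega.F_lt_one hP hx.1 ((Omega.le_W hP hx.1).lt_of_ne hne)).false
  have h2 : S.Q1 S.V2.1 S.V2.2 < 0 :=
    not_le.1 ((max_le_iff_Q1_V2 hP).not.1 (not_le.2 hmax))
  subst hω
  exact h2.ne hx.2

omit h3 hmax in
-- A zero inner mean puts the point on the lower boundary, where `Q2 = -Q1 = 0`; it would lie in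
-- `Omega2`, which is empty above `P4`.
lemma curve_mean_pos (h4 : S.P4 < S.Pnorm) {ω F : ℝ} (hx : (ω, F) ∈ S.curve) :
    0 < ω - S.Pnorm / F := by
  refine (Omega.mean_nonneg hP hx.1).lt_of_ne fun h0 => ?_
  have hF := Omega.F_pos hP hx.1
  have e : F = S.Pnorm / ω := by
    have h1 : ω = S.Pnorm / F := by linarith
    rw [h1, div_div_cancel₀ S.Pnorm_pos.ne']
  have hQ := Q1_lower hP (Omega.V1_le hP hx.1) (Omega.le_W hP hx.1)
  rw [← e] at hQ
  have hQ1 : S.Q1 ω F = 0 := hx.2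
  have hmem : (ω, F) ∈ S.Omega2 := ⟨hx.1, sub_nonneg.1 (by
    change 0 ≤ S.Q2 ω F
    linarith)⟩
  exact absurd ((Omega2_nonempty_iff hP).1 ⟨_, hmem⟩) (not_le.2 h4)

end Intermediate

end Optimal

end RelaySystem

/-! ### Assembly of the theorem. -/

theorem mainTheorem3 (S : RelaySystem) (hP : S.Pnorm < S.P0) :
    -- the fourth threshold is well defined
    (0 < S.P4 ∧ ∀ x : ℝ, 0 < x → (S.P4Ineq x ↔ S.P4 ≤ x)) ∧
    -- reduction of the allocation problem to the region `Ω`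
    (∀ f ω, S.IsFeasible f ω →
      ω < S.pmax ∧ (ω, f.real (Set.Icc 0 ω)) ∈ S.Omega ∧
      ∃ g, S.IsInner ω (f.real (Set.Icc 0 ω)) g ∧
        S.R1 f ω = S.innerR1 ω (f.real (Set.Icc 0 ω)) g ∧
        S.R2 f ≤ S.innerR2 ω (f.real (Set.Icc 0 ω)) g) ∧
    (∀ ω F g, (ω, F) ∈ S.Omega → S.IsInner ω F g →
      S.IsFeasible (S.glue ω F g) ω ∧ S.R1 (S.glue ω F g) ω = S.innerR1 ω F g ∧
        S.R2 (S.glue ω F g) = S.innerR2 ω F g) ∧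
    (∀ R : ℝ, IsGreatest S.rates R ↔ IsGreatest S.omegaRates R) ∧
    -- the reduced problem on each subregion
    (∀ ω F, (ω, F) ∈ S.Omega1 → IsGreatest (S.innerRates ω F) (S.R2max ω F)) ∧
    (∀ ω F, (ω, F) ∈ S.Omega2 → IsGreatest (S.innerRates ω F) (S.R1max ω)) ∧
    (∀ ω F, (ω, F) ∈ S.Omega3 → ∀ g, S.IsInner ω F g →
      ∃ g', S.IsInner ω F g' ∧ S.innerR1 ω F g' = S.innerR2 ω F g' ∧
        min (S.innerR1 ω F g) (S.innerR2 ω F g) ≤ S.innerR1 ω F g') ∧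
    -- existence of the subregions
    (S.Pnorm ≤ S.P3 ↔ 0 ≤ S.Q2 S.V1.1 S.V1.2) ∧
    (S.P2 ≤ S.Pnorm ↔ 0 ≤ S.Q1 S.V2.1 S.V2.2) ∧
    (S.P4 ≤ S.Pnorm ↔ 0 ≤ S.Q1 S.V3.1 S.V3.2) ∧
    (S.Omega2 = S.Omega ↔ S.Pnorm ≤ S.P3) ∧
    (S.Omega1 = S.Omega ↔ max S.P2 S.P4 ≤ S.Pnorm) ∧
    (S.Omega1.Nonempty ↔ S.P3 ≤ S.Pnorm) ∧
    (S.Omega2.Nonempty ↔ S.Pnorm ≤ S.P4) ∧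
    (S.Omega3.Nonempty ↔ S.P3 < S.Pnorm ∧ S.Pnorm < max S.P2 S.P4) ∧
    -- half-duplex case
    (S.Pnorm ≤ S.P3 →
      S.IsOptimal (RelaySystem.twoPoint (S.pavg / S.pmax) S.pmax 0) S.V1.1 ∧
      S.rate (RelaySystem.twoPoint (S.pavg / S.pmax) S.pmax 0) S.V1.1 =
        (1 - S.pavg / S.pmax) *
          Real.log (1 + S.pmax * S.Pnorm * S.β₀ / (S.pmax - S.pavg)) ∧
      S.sourcePower S.V1.1 S.pmax = 0 ∧
      S.sourcePower S.V1.1 0 =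
        S.β / ‖S.h₁‖ ^ 2 * (S.pmax * S.Pnorm / (S.pmax - S.pavg))) ∧
    -- full-duplex case
    (max S.P2 S.P4 ≤ S.Pnorm →
      S.IsOptimal (MeasureTheory.Measure.dirac S.pavg) (S.Pnorm + S.pavg) ∧
      S.rate (MeasureTheory.Measure.dirac S.pavg) (S.Pnorm + S.pavg) =
        Real.log (1 + S.pavg * S.v) ∧
      S.sourcePower (S.Pnorm + S.pavg) S.pavg = S.β / ‖S.h₁‖ ^ 2 * S.Pnorm ∧
      S.sourcePower (S.Pnorm + S.pavg) S.pavg = S.Pavg) ∧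
    -- intermediate case
    (S.β₀ ≤ S.v → S.P3 < S.Pnorm → S.Pnorm < max S.P2 S.P4 →
      (∃ x ∈ S.curve, ∀ y ∈ S.curve, S.R1min y.1 y.2 ≤ S.R1min x.1 x.2) ∧
      ∀ ω F : ℝ, (ω, F) ∈ S.curve →
        (∀ y ∈ S.curve, S.R1min y.1 y.2 ≤ S.R1min ω F) →
        0 < F ∧ F < 1 ∧
        S.IsOptimal (RelaySystem.twoPoint (1 - F) (S.upperMean ω F) (ω - S.Pnorm / F)) ω ∧
        S.rate (RelaySystem.twoPoint (1 - F) (S.upperMean ω F) (ω - S.Pnorm / F)) ω =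
          S.R1min ω F ∧
        0 < S.upperMean ω F ∧ S.sourcePower ω (S.upperMean ω F) = 0 ∧
        0 ≤ ω - S.Pnorm / F ∧ (S.P4 < S.Pnorm → 0 < ω - S.Pnorm / F) ∧
        S.sourcePower ω (ω - S.Pnorm / F) = S.β / ‖S.h₁‖ ^ 2 * (S.Pnorm / F)) := by
  have hβ : S.β / ‖S.h₁‖ ^ 2 * S.Pnorm = S.Pavg := by
    have h1 : ‖S.h₁‖ ≠ 0 := norm_ne_zero_iff.2 S.h₁_ne
    have h2 := S.β_pos.ne'
    unfold RelaySystem.Pnorm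
    field_simp
  have hPp := S.Pnorm_pos
  refine ⟨⟨S.P4_spec.1, S.P4_spec.2.2⟩,
    fun f ω hf => ⟨RelaySystem.Omega.lt_pmax hP (hf.mem_Omega hP), hf.mem_Omega hP,
      hf.exists_inner hP⟩,
    fun ω F g hx hg => RelaySystem.glue_spec hP hx hg,
    RelaySystem.isGreatest_rates_iff hP,
    fun ω F h => RelaySystem.isGreatest_innerRates_Omega1 hP h,
    fun ω F h => RelaySystem.isGreatest_innerRates_Omega2 hP h,
    fun ω F h g hg => ?_, RelaySystem.le_P3_iff hP, RelaySystem.P2_le_iff hP,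
    RelaySystem.P4_le_iff hP, RelaySystem.Omega2_eq_iff hP, RelaySystem.Omega1_eq_iff hP,
    RelaySystem.Omega1_nonempty_iff hP, RelaySystem.Omega2_nonempty_iff hP,
    RelaySystem.Omega3_nonempty_iff hP, fun h => ?_, fun h => ?_, fun hv h3 hmax => ?_⟩
  · obtain ⟨h1, h2⟩ := (RelaySystem.mem_Omega3_iff h.1).1 h
    exact RelaySystem.exists_balanced_inner hP h.1 (sub_neg.1 h1) (sub_neg.1 h2) hg
  · obtain ⟨h1, h2⟩ := RelaySystem.half_duplex hP h
    refine ⟨h1, ?_, ?_, ?_⟩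
    · rw [h2, RelaySystem.R1max, ← RelaySystem.V1_snd hP]
      change (1 - S.pavg / S.pmax) *
        Real.log (1 + S.β₀ * (S.pmax * S.Pnorm / (S.pmax - S.pavg))) = _
      rw [← mul_div_assoc, mul_comm S.β₀]
    · have := RelaySystem.Omega.lt_pmax hP (RelaySystem.V1_mem hP)
      rw [RelaySystem.sourcePower, max_eq_right (sub_nonpos.2 this.le), mul_zero]
    · rw [RelaySystem.sourcePower, sub_zero, max_eq_left (RelaySystem.V1_fst_pos hP).le]
      rfl
  · obtain ⟨h1, h2⟩ := RelaySystem.full_duplex hP h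
    have e : S.sourcePower (S.Pnorm + S.pavg) S.pavg = S.β / ‖S.h₁‖ ^ 2 * S.Pnorm := by
      rw [RelaySystem.sourcePower, add_sub_cancel_right, max_eq_left hPp.le]
    exact ⟨h1, by rw [h2, mul_comm S.v], e, e.trans hβ⟩
  · refine ⟨RelaySystem.exists_max_on_curve hP h3 hmax, fun ω F hx hbest => ?_⟩
    have hF1 := RelaySystem.curve_F_lt_one hP hmax hx
    have hF := RelaySystem.Omega.F_pos hP hx.1
    have hm := RelaySystem.Omega.le_upperMean hP hx.1 hF1
    obtain ⟨h1, h2⟩ := RelaySystem.twoPoint_spec hP hx.1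
    have hQ : S.R1min ω F = S.R2max ω F := sub_eq_zero.1 hx.2
    rw [← hQ, min_self] at h2
    refine ⟨hF, hF1, ⟨h1, fun f' ω' hf' => ?_⟩, h2,
      (RelaySystem.Omega.pos hP hx.1).trans_le hm, ?_,
      RelaySystem.Omega.mean_nonneg hP hx.1,
      fun h4 => RelaySystem.curve_mean_pos hP h4 hx, ?_⟩
    · obtain ⟨y, hy, hle⟩ := RelaySystem.exists_curve_rate_le hP h3 hmax hv hf'
      rw [h2]
      exact hle.trans (hbest y hy)
    · rw [RelaySystem.sourcePower, max_eq_right (sub_nonpos.2 hm), mul_zero]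
    · rw [RelaySystem.sourcePower, sub_sub_cancel, max_eq_left (div_pos hPp hF).le]
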